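/- Setting. Let $\Omega\subset\mathbb R^d$ be open and bounded with Lipschitz boundary, and let $\rho_X$ be a Lipschitz continuous probability density on $\Omega$ with $0<\rho_{min}\le\rho_X\le\rho_{max}$. Let $\eta:[0,\infty)\to[0,\infty)$ be (weakly) decreasing with $\eta(0)>0$, $\int_{\mathbb R^d}\eta(|z|)\,dz=1$ and $\int_{\mathbb R^d}\eta(|z|)|z|^k\,dz<\infty$ for $1\le k\le 4$. Let $\sigma:\Omega\to(0,\infty)$ be continuous with $0<\sigma_{min}\le\sigma\le\sigma_{max}$. For $h>0$ write $\eta_h(t)=h^{-d}\eta(t/h)$, and for $r\ge0$ write $\gamma(r)=\int_{|z|\ge r}\eta(|z|)\,dz$. For points $x_1,\dots,x_n\in\Omega$, $h>0$ and $T:\Omega\to\mathbb R^m$ put $h_i=\sigma(x_i)h$, $d_i=\sum_{j=1}^n\eta_{h_i}(|x_i-x_j|)$, $$\mathcal A_n[T]=\frac1n\sum_{i=1}^n\frac1{d_i}\sum_{j=1}^n\eta_{h_i}(|x_i-x_j|)\log\left(1+h^{-2}|T(x_i)-T(x_j)|^2\right),$$ and $$\mathcal A[T;\Phi_1]=\int_\Omega\Phi_1(\sigma(x)DT(x))\rho_X(x)\,dx,\qquad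 \Phi_1(A)=\int_{\mathbb R^d}\eta(|z|)\log(1+|Az|^2)\,dz .$$ $\mathrm{Lip}(T)$ and $\mathrm{Lip}(DT)$ denote the smallest Lipschitz constants of $T$ and $DT$ on $\Omega$ (with the operator norm on matrices). Theorem 2.4. There are constants $C\ge1$ and $0<c\le1$, depending only on $d,m,\Omega,\rho_X,\eta,\sigma$ and on $\rho_{min},\rho_{max},\sigma_{min},\sigma_{max}$, such that the following holds. Let $T:\Omega\to\mathbb R^m$ be differentiable with $T$ and $DT$ Lipschitz continuous on $\Omega$, let $n\ge2$, $0<h\le c$, $nh^d\ge C$, $r\ge h$, $\lambda\ge0$ and $\lambda^2\le c\,nh^d$, and let $x_1,\dots,x_n$ be i.i.d. random variables with density $\rho_X$. Then, with probability at least $1-3n\exp(-\lambda^2)$, $$\left|\mathcal A_n[T]-\mathcal A[T;\Phi_1]\right|\le C\left(\mathrm{Lip}(T)^2+\mathrm{Lip}(DT)^2\right)\left(\frac{\lambda}{\sqrt{nh^d}}+\gamma\left(\frac{r}{h\sigma_{max}}\right)+r\right).$$ -/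

import Mathlib

open MeasureTheory ProbabilityTheory
open scoped NNReal ENNReal

noncomputable section

namespace TSNE

/-- `Ω` has Lipschitz boundary: near each boundary point `p`, for a suitable unit vector `ν` (the
vertical axis of a rotated coordinate system), `Ω` is the strict epigraph over the hyperplane `ν^⊥`
of a Lipschitz function `g`. Here `x - ⟪ν, x⟫ ν` is the orthogonal projection of `x` onto `ν^⊥`. -/
def HasLipschitzBoundary {d : ℕ} (Ω : Set (EuclideanSpace ℝ (Fin d))) : Prop :=
  ∀ p ∈ frontier Ω, ∃ (ν : EuclideanSpace ℝ (Fin d)) (R : ℝ) (K : ℝ≥0)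
    (g : EuclideanSpace ℝ (Fin d) → ℝ),
    ‖ν‖ = 1 ∧ 0 < R ∧ LipschitzWith K g ∧
      ∀ x ∈ Metric.ball p R,
        (x ∈ Ω ↔ g (x - (inner ℝ ν x : ℝ) • ν) < (inner ℝ ν x : ℝ))

/-- `f` is Lipschitz continuous on `s`. -/
def IsLipschitzOn {X Y : Type*} [PseudoMetricSpace X] [PseudoMetricSpace Y]
    (f : X → Y) (s : Set X) : Prop :=
  ∃ K : ℝ≥0, LipschitzOnWith K f s

/-- `Lip(f)`: the smallest Lipschitz constant of `f` on `s`. -/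
def lip {X Y : Type*} [PseudoMetricSpace X] [PseudoMetricSpace Y]
    (f : X → Y) (s : Set X) : ℝ≥0 :=
  sInf {K : ℝ≥0 | LipschitzOnWith K f s}

/-- For a Lipschitz function, `lip f s` is itself a Lipschitz constant: the infimum is attained. -/
theorem IsLipschitzOn.lipschitzOnWith_lip {X Y : Type*} [PseudoMetricSpace X]
    [PseudoMetricSpace Y] {f : X → Y} {s : Set X} (hf : IsLipschitzOn f s) :
    LipschitzOnWith (lip f s) f s := by
  have hcl : IsClosed {K : ℝ≥0 | LipschitzOnWith K f s} := by
    have : {K : ℝ≥0 | LipschitzOnWith K f s} =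
        ⋂ x ∈ s, ⋂ y ∈ s, {K : ℝ≥0 | dist (f x) (f y) ≤ K * dist x y} := by
      ext K
      simp [lipschitzOnWith_iff_dist_le_mul]
    rw [this]
    exact isClosed_biInter fun x _ => isClosed_biInter fun y _ =>
      isClosed_le continuous_const (NNReal.continuous_coe.mul continuous_const)
  exact hcl.csInf_mem hf (OrderBot.bddBelow _)

/-- The rescaled kernel `η_h(t) = h^{-d} η(t / h)`. -/
def kernel (d : ℕ) (η : ℝ → ℝ) (h t : ℝ) : ℝ :=
  (h ^ d)⁻¹ * η (t / h)

/-- The degree `d_i = ∑_j η_{h_i}(|x_i - x_j|)` (the term `j = i` included), `h_i = σ(x_i) h`. -/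
def degree {d n : ℕ} (η : ℝ → ℝ) (σ : EuclideanSpace ℝ (Fin d) → ℝ) (h : ℝ)
    (x : Fin n → EuclideanSpace ℝ (Fin d)) (i : Fin n) : ℝ :=
  ∑ j, kernel d η (σ (x i) * h) ‖x i - x j‖

/-- The discrete rescaled t-SNE attraction `A_n[T]` of the data points `x_1, …, x_n`. -/
def discreteAttraction {d m n : ℕ} (η : ℝ → ℝ) (σ : EuclideanSpace ℝ (Fin d) → ℝ) (h : ℝ)
    (T : EuclideanSpace ℝ (Fin d) → EuclideanSpace ℝ (Fin m))
    (x : Fin n → EuclideanSpace ℝ (Fin d)) : ℝ :=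
  (1 / (n : ℝ)) * ∑ i, (1 / degree η σ h x i) *
    ∑ j, kernel d η (σ (x i) * h) ‖x i - x j‖ *
      Real.log (1 + (h ^ 2)⁻¹ * ‖T (x i) - T (x j)‖ ^ 2)

/-- `Φ_s(A) = ∫ η(|z|) log(s^{-2} + |A z|^2) dz`, for `0 < s < ∞`. -/
def Phi {d m : ℕ} (η : ℝ → ℝ) (s : ℝ)
    (A : EuclideanSpace ℝ (Fin d) →L[ℝ] EuclideanSpace ℝ (Fin m)) : ℝ :=
  ∫ z : EuclideanSpace ℝ (Fin d), η ‖z‖ * Real.log ((s ^ 2)⁻¹ + ‖A z‖ ^ 2)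

/-- The continuum attraction `A[T; Φ_s] = ∫_Ω Φ_s(σ DT) ρ dx`. -/
def continuumAttraction {d m : ℕ} (Ω : Set (EuclideanSpace ℝ (Fin d)))
    (ρ : EuclideanSpace ℝ (Fin d) → ℝ) (η : ℝ → ℝ) (σ : EuclideanSpace ℝ (Fin d) → ℝ) (s : ℝ)
    (T : EuclideanSpace ℝ (Fin d) → EuclideanSpace ℝ (Fin m)) : ℝ :=
  ∫ x in Ω, Phi η s (σ x • fderiv ℝ T x) * ρ x

/-- The tail mass `γ(r) = ∫_{|z| ≥ r} η(|z|) dz` of the kernel in `ℝ^d`. -/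
def tailMass (d : ℕ) (η : ℝ → ℝ) (r : ℝ) : ℝ :=
  ∫ z in {z : EuclideanSpace ℝ (Fin d) | r ≤ ‖z‖}, η ‖z‖

/-- `ρ` is a Lipschitz probability density on `Ω` with `ρmin ≤ ρ ≤ ρmax` and `ρmin > 0`. -/
structure IsDataDensity {d : ℕ} (Ω : Set (EuclideanSpace ℝ (Fin d)))
    (ρ : EuclideanSpace ℝ (Fin d) → ℝ) (ρmin ρmax : ℝ) : Prop where
  lipschitz : IsLipschitzOn ρ Ω
  min_pos : 0 < ρmin
  lower : ∀ x ∈ Ω, ρmin ≤ ρ x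
  upper : ∀ x ∈ Ω, ρ x ≤ ρmax
  mass_one : ∫ x in Ω, ρ x = 1

/-- `η : [0, ∞) → [0, ∞)` is decreasing, `η(0) > 0`, has unit mass on `ℝ^d`, and its moments of
orders `1, …, 4` are finite. Only the values of `η` on `[0, ∞)` matter. -/
structure IsGraphKernel (d : ℕ) (η : ℝ → ℝ) : Prop where
  nonneg : ∀ t, 0 ≤ t → 0 ≤ η t
  antitone : AntitoneOn η (Set.Ici 0)
  zero_pos : 0 < η 0
  mass_one : ∫ z : EuclideanSpace ℝ (Fin d), η ‖z‖ = 1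
  moments : ∀ k ∈ Finset.Icc 1 4,
    Integrable (fun z : EuclideanSpace ℝ (Fin d) => η ‖z‖ * ‖z‖ ^ k)

/-- `σ` is continuous on `Ω` with `σmin ≤ σ ≤ σmax` and `σmin > 0`. -/
structure IsBandwidth {d : ℕ} (Ω : Set (EuclideanSpace ℝ (Fin d)))
    (σ : EuclideanSpace ℝ (Fin d) → ℝ) (σmin σmax : ℝ) : Prop where
  continuous : ContinuousOn σ Ω
  min_pos : 0 < σmin
  lower : ∀ x ∈ Ω, σmin ≤ σ x
  upper : ∀ x ∈ Ω, σ x ≤ σmax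

/-- The law `ρ dx` on `Ω` of a single data point. -/
def dataLaw {d : ℕ} (Ω : Set (EuclideanSpace ℝ (Fin d)))
    (ρ : EuclideanSpace ℝ (Fin d) → ℝ) : Measure (EuclideanSpace ℝ (Fin d)) :=
  (volume.restrict Ω).withDensity fun x => ENNReal.ofReal (ρ x)

end TSNE

end

/-!
# The t-SNE attraction of a random sample and its continuum limit

Given a data point at `x`, the degree `d_i / n` and the row sum of the attraction are averages of
independent bounded variables with means `meanDegree` and `meanAttraction`. Bernstein's inequality,
applied conditionally on the row point (`measureReal_abs_rowSum_sub_le`), controls all `2 n` averages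
at once up to `lam / √(n h ^ d)`. In the same way the sample mean of the quotient
`meanAttraction / meanDegree` concentrates about its integral, so that the discrete attraction is
close to `∫ (meanAttraction / meanDegree) ρ` (`abs_discreteAttraction_sub_le`). All the kernels are
divided by `Lip(T)²` for this purpose, which makes the probabilistic constants independent of `T`.

The quotient is compared with `Φ₁(σ DT)` after the change of variables `y = x + σ(x) h z`. While
`y` stays in the largest ball about `x` inside `Ω`, Taylor's formula gives an error `O(h)`. For all
other `y` both integrands are bounded by `C |z|²`, and since the moments of the kernel up to order
four are finite, their total is at most a multiple of `layerWeight = min 1 (h / dist(x, Ωᶜ))²`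
(`abs_integrand_sub_le`, `exists_abs_div_sub_Phi_le`). No extension of `T` across the boundary is
needed. The boundary layers of a Lipschitz domain of width `s` have volume `O(s)`
(`exists_volume_layer_le`), so the weight has integral `O(h)` (`setIntegral_layerWeight_le`). This
bounds the bias by `O(h)`, hence by `O(r)`, without using the tail mass of the kernel. The interior
cone property (`exists_ball_subset`) bounds the degrees from below up to the boundary
(`exists_le_meanDegree`).
-/

namespace TSNE

/-! ### Concentration for sums over an i.i.d. sample -/

section Concentration

variable {α : Type*} [MeasurableSpace α] {μ : Measure α} [IsProbabilityMeasure μ]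

lemma integrable_of_abs_le {f : α → ℝ} (hf : Measurable f) {M : ℝ} (hM : ∀ x, |f x| ≤ M) :
    Integrable f μ :=
  Integrable.of_bound hf.aestronglyMeasurable M (Filter.Eventually.of_forall hM)

/-- The Bernstein bound on the moment generating function of a bounded centred variable, from
`exp t ≤ 1 + t + t ^ 2` for `|t| ≤ 1`. -/
lemma integral_exp_mul_le {Z : α → ℝ} (hZ : Measurable Z) {M V s : ℝ} (hM : ∀ x, |Z x| ≤ M)
    (h0 : ∫ x, Z x ∂μ = 0) (hV : ∫ x, Z x ^ 2 ∂μ ≤ V) (hs : 0 ≤ s) (hsM : s * M ≤ 1) :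
    ∫ x, Real.exp (s * Z x) ∂μ ≤ Real.exp (s ^ 2 * V) := by
  have hle : ∀ x, |s * Z x| ≤ 1 := fun x => by
    rw [abs_mul, abs_of_nonneg hs]
    exact (mul_le_mul_of_nonneg_left (hM x) hs).trans hsM
  have hpt : ∀ x, Real.exp (s * Z x) ≤ 1 + s * Z x + s ^ 2 * Z x ^ 2 := fun x => by
    have := (abs_le.1 (Real.abs_exp_sub_one_sub_id_le (hle x))).2
    nlinarith [this]
  have i1 : Integrable Z μ := integrable_of_abs_le hZ hM
  have i2 : Integrable (fun x => Z x ^ 2) μ :=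
    integrable_of_abs_le (M := M ^ 2) (hZ.pow_const 2) fun x => by
      rw [abs_pow]; exact pow_le_pow_left₀ (abs_nonneg _) (hM x) 2
  have i3 : Integrable (fun x => Real.exp (s * Z x)) μ :=
    integrable_of_abs_le (M := Real.exp 1) (hZ.const_mul s).exp fun x => by
      rw [abs_of_pos (Real.exp_pos _)]
      exact Real.exp_le_exp.2 ((le_abs_self _).trans (hle x))
  have i4 : Integrable (fun x => 1 + s * Z x) μ := (integrable_const 1).add (i1.const_mul s)
  calc ∫ x, Real.exp (s * Z x) ∂μ ≤ ∫ x, (1 + s * Z x + s ^ 2 * Z x ^ 2) ∂μ :=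
        integral_mono i3 (i4.add (i2.const_mul _)) hpt
    _ = 1 + s ^ 2 * ∫ x, Z x ^ 2 ∂μ := by
        rw [integral_add i4 (i2.const_mul _), integral_add (integrable_const 1) (i1.const_mul s),
          integral_const_mul, integral_const_mul, h0]
        simp
    _ ≤ 1 + s ^ 2 * V := by gcongr
    _ ≤ Real.exp (s ^ 2 * V) := by linarith [Real.add_one_le_exp (s ^ 2 * V)]

/-- Chernoff's method with `integral_exp_mul_le`: an upper tail bound of Bernstein type, with the
exponent `s` left free. -/
lemma measureReal_le_sum_le_exp {Z : α → ℝ} (hZ : Measurable Z) {M V s : ℝ}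
    (hM : ∀ x, |Z x| ≤ M) (h0 : ∫ x, Z x ∂μ = 0) (hV : ∫ x, Z x ^ 2 ∂μ ≤ V) (hs : 0 ≤ s)
    (hsM : s * M ≤ 1) (n : ℕ) (τ : ℝ) :
    (Measure.pi fun _ : Fin n => μ).real {y | τ ≤ ∑ j, Z (y j)} ≤
      Real.exp (n * (s ^ 2 * V) - s * τ) := by
  have hm : Measurable fun y : Fin n → α => ∑ j, Z (y j) :=
    Finset.measurable_sum _ fun j _ => hZ.comp (measurable_pi_apply j)
  have hint : Integrable (fun y : Fin n → α => Real.exp (s * ∑ j, Z (y j)))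
      (Measure.pi fun _ : Fin n => μ) :=
    integrable_of_abs_le (M := Real.exp (n : ℝ)) (hm.const_mul s).exp fun y => by
      rw [abs_of_pos (Real.exp_pos _), Finset.mul_sum]
      refine Real.exp_le_exp.2 ((Finset.sum_le_sum fun j _ => ?_).trans
        (by simp : (∑ _j : Fin n, (1 : ℝ)) ≤ n))
      exact (mul_le_mul_of_nonneg_left ((le_abs_self _).trans (hM _)) hs).trans hsM
  refine (measure_ge_le_exp_mul_mgf τ hs hint).trans ?_
  have hmgf : mgf (fun y : Fin n → α => ∑ j, Z (y j)) (Measure.pi fun _ : Fin n => μ) s =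
      (∫ x, Real.exp (s * Z x) ∂μ) ^ n := by
    have := integral_fintype_prod_eq_prod (𝕜 := ℝ) (μ := fun _ : Fin n => μ)
      (fun _ x => Real.exp (s * Z x))
    simp only [mgf, Finset.mul_sum, Real.exp_sum]
    rw [this]
    simp
  rw [hmgf, sub_eq_add_neg, add_comm, Real.exp_add, ← neg_mul, Real.exp_nat_mul]
  gcongr
  exact integral_exp_mul_le hZ hM h0 hV hs hsM

/-- Two-sided Bernstein bound for a function with values in `[0, M]`. -/
lemma measureReal_abs_sum_sub_le {f : α → ℝ} (hf : Measurable f) {M V s : ℝ}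
    (hf0 : ∀ x, 0 ≤ f x) (hM : ∀ x, f x ≤ M) (hV : ∫ x, f x ^ 2 ∂μ ≤ V) (hs : 0 ≤ s)
    (hsM : s * M ≤ 1) (n : ℕ) (τ : ℝ) :
    (Measure.pi fun _ : Fin n => μ).real {y | τ < |∑ j, f (y j) - n * ∫ x, f x ∂μ|} ≤
      2 * Real.exp (n * (s ^ 2 * V) - s * τ) := by
  have habs : ∀ x, |f x| ≤ M := fun x => by rw [abs_of_nonneg (hf0 x)]; exact hM x
  have hi : Integrable f μ := integrable_of_abs_le hf habs
  have hi2 : Integrable (fun x => f x ^ 2) μ :=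
    integrable_of_abs_le (M := M ^ 2) (hf.pow_const 2) fun x => by
      rw [abs_pow]; exact pow_le_pow_left₀ (abs_nonneg _) (habs x) 2
  set e := ∫ x, f x ∂μ with he
  have he0 : 0 ≤ e := integral_nonneg hf0
  have heM : e ≤ M := by
    have := integral_mono hi (integrable_const M) hM
    simpa using this
  have hZm : Measurable fun x => f x - e := hf.sub_const e
  have hZM : ∀ x, |f x - e| ≤ M := fun x => abs_le.2 ⟨by linarith [hf0 x], by linarith [hM x]⟩
  have hZ0 : ∫ x, (f x - e) ∂μ = 0 := by
    rw [integral_sub hi (integrable_const e)]; simp [he]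
  have hZV : ∫ x, (f x - e) ^ 2 ∂μ ≤ V := by
    have : ∫ x, (f x - e) ^ 2 ∂μ = ∫ x, f x ^ 2 ∂μ - e ^ 2 := by
      have h1 : ∀ x, (f x - e) ^ 2 = f x ^ 2 - (2 * e * f x - e ^ 2) := fun x => by ring
      simp_rw [h1]
      have i3 : Integrable (fun x => 2 * e * f x - e ^ 2) μ :=
        (hi.const_mul _).sub (integrable_const _)
      rw [integral_sub hi2 i3, integral_sub (hi.const_mul _) (integrable_const _),
        integral_const_mul]
      simp only [integral_const, probReal_univ, smul_eq_mul, one_mul, ← he]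
      ring
    nlinarith [sq_nonneg e]
  have h1 := measureReal_le_sum_le_exp hZm hZM hZ0 hZV hs hsM n τ
  have h2 := measureReal_le_sum_le_exp (Z := fun x => -(f x - e)) hZm.neg
    (fun x => by rw [abs_neg]; exact hZM x) (by rw [integral_neg, hZ0, neg_zero])
    (by simpa only [neg_sq] using hZV) hs hsM n τ
  have hsub : {y : Fin n → α | τ < |∑ j, f (y j) - n * e|} ⊆
      {y | τ ≤ ∑ j, (f (y j) - e)} ∪ {y | τ ≤ ∑ j, -(f (y j) - e)} := by
    intro y hy
    simp only [Set.mem_ofPred_eq, Set.mem_union, Finset.sum_neg_distrib, Finset.sum_sub_distrib,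
      Finset.sum_const, Finset.card_univ, Fintype.card_fin, nsmul_eq_mul] at hy ⊢
    rcases lt_abs.1 hy with h | h
    · exact Or.inl h.le
    · exact Or.inr h.le
  calc _ ≤ _ := measureReal_mono hsub
    _ ≤ _ := measureReal_union_le _ _
    _ ≤ _ := by linarith

/-- Bernstein's bound for the row sums of a kernel `a`, conditionally on the row point `x i`. The
diagonal term is not random given `x i`; exchanging it for its mean costs at most `M`. -/
lemma measureReal_abs_rowSum_sub_le {a : α → α → ℝ} (ha : Measurable (Function.uncurry a))
    {M V s : ℝ} (ha0 : ∀ x y, 0 ≤ a x y) (hM : ∀ x y, a x y ≤ M)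
    (hV : ∀ x, ∫ y, a x y ^ 2 ∂μ ≤ V) (hs : 0 ≤ s) (hsM : s * M ≤ 1) {n : ℕ} (i : Fin n)
    (τ : ℝ) :
    (Measure.pi fun _ : Fin n => μ).real
        {x | τ + M < |∑ j, a (x i) (x j) - n * ∫ y, a (x i) y ∂μ|} ≤
      2 * Real.exp (n * (s ^ 2 * V) - s * τ) := by
  obtain ⟨k, rfl⟩ : ∃ k, n = k + 1 := ⟨n - 1, by have := i.pos; omega⟩
  have hme : Measurable fun x => ∫ y, a x y ∂μ :=
    (ha.stronglyMeasurable.integral_prod_right (ν := μ)).measurable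
  have hax : ∀ x, Measurable (a x) := fun x => ha.comp measurable_prodMk_left
  have he0 : ∀ x, 0 ≤ ∫ y, a x y ∂μ := fun x => integral_nonneg (ha0 x)
  have heM : ∀ x, ∫ y, a x y ∂μ ≤ M := fun x => by
    have hi : Integrable (a x) μ := integrable_of_abs_le (hax x) (M := M) fun y => by
      rw [abs_of_nonneg (ha0 x y)]; exact hM x y
    have := integral_mono hi (integrable_const M) (hM x)
    simpa using this
  have hV0 : ∀ x : α, 0 ≤ V := fun x => (integral_nonneg fun y => sq_nonneg _).trans (hV x)
  have hmp := measurePreserving_piFinSuccAbove (fun _ : Fin (k + 1) => μ) i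
  set B : Set (α × (Fin k → α)) :=
    {p | τ < |∑ j, a p.1 (p.2 j) - k * ∫ y, a p.1 y ∂μ|} with hB
  have hBm : MeasurableSet B := by
    refine measurableSet_lt measurable_const ?_
    have h1 : Measurable fun p : α × (Fin k → α) => ∑ j, a p.1 (p.2 j) :=
      Finset.measurable_sum _ fun j _ =>
        ha.comp (measurable_fst.prodMk ((measurable_pi_apply j).comp measurable_snd))
    exact (h1.sub ((hme.comp measurable_fst).const_mul _)).abs
  have hsub : {x : Fin (k + 1) → α |
      τ + M < |∑ j, a (x i) (x j) - ((k + 1 : ℕ) : ℝ) * ∫ y, a (x i) y ∂μ|} ⊆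
      (MeasurableEquiv.piFinSuccAbove (fun _ => α) i) ⁻¹' B := by
    intro x hx
    simp only [Set.mem_ofPred_eq, Set.mem_preimage, hB, MeasurableEquiv.piFinSuccAbove_apply,
      Fin.insertNthEquiv_symm_apply, Fin.removeNth_apply] at hx ⊢
    rw [Fin.sum_univ_succAbove _ i] at hx
    have hd : |a (x i) (x i) - ∫ y, a (x i) y ∂μ| ≤ M :=
      abs_le.2 ⟨by linarith [ha0 (x i) (x i), heM (x i)], by linarith [hM (x i) (x i), he0 (x i)]⟩
    have heq : a (x i) (x i) + ∑ j, a (x i) (x (i.succAbove j)) -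
        ((k + 1 : ℕ) : ℝ) * ∫ y, a (x i) y ∂μ =
        (a (x i) (x i) - ∫ y, a (x i) y ∂μ) +
          (∑ j, a (x i) (x (i.succAbove j)) - k * ∫ y, a (x i) y ∂μ) := by
      push_cast; ring
    rw [heq] at hx
    have := abs_add_le (a (x i) (x i) - ∫ y, a (x i) y ∂μ)
      (∑ j, a (x i) (x (i.succAbove j)) - k * ∫ y, a (x i) y ∂μ)
    linarith
  have hsec : ∀ x, (Measure.pi fun _ : Fin k => μ) (Prod.mk x ⁻¹' B) ≤
      ENNReal.ofReal (2 * Real.exp ((k + 1 : ℕ) * (s ^ 2 * V) - s * τ)) := by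
    intro x
    have h := measureReal_abs_sum_sub_le (hax x) (ha0 x) (hM x) (hV x) hs hsM k τ
    rw [← ofReal_measureReal (measure_ne_top _ _)]
    refine ENNReal.ofReal_le_ofReal (h.trans ?_)
    gcongr
    · exact mul_nonneg (sq_nonneg _) (hV0 x)
    · omega
  have hprod : (μ.prod (Measure.pi fun _ : Fin k => μ)) B ≤
      ENNReal.ofReal (2 * Real.exp ((k + 1 : ℕ) * (s ^ 2 * V) - s * τ)) := by
    rw [Measure.prod_apply hBm]
    refine (lintegral_mono hsec).trans ?_
    simp
  refine (measureReal_mono hsub).trans ?_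
  rw [measureReal_def, hmp.measure_preimage hBm.nullMeasurableSet]
  exact ENNReal.toReal_le_of_le_ofReal (by positivity) hprod

end Concentration

/-! ### Bounded Lipschitz domains -/

section Geometry

variable {d : ℕ} {Ω : Set (EuclideanSpace ℝ (Fin d))}

lemma norm_sub_inner_smul_le {ν : EuclideanSpace ℝ (Fin d)} (hν : ‖ν‖ = 1)
    (w : EuclideanSpace ℝ (Fin d)) : ‖w - (inner ℝ ν w : ℝ) • ν‖ ≤ 2 * ‖w‖ := by
  have h := abs_real_inner_le_norm ν w
  have h2 := norm_sub_le w ((inner ℝ ν w : ℝ) • ν)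
  rw [norm_smul, hν, Real.norm_eq_abs] at h2
  rw [hν] at h
  linarith

/-- A Lipschitz function of the orthogonal projection to `ν^⊥` is Lipschitz; the crude constant `2`
bounds the norm of the projection. -/
lemma abs_comp_proj_sub_le {ν : EuclideanSpace ℝ (Fin d)} (hν : ‖ν‖ = 1) {K : ℝ≥0}
    {g : EuclideanSpace ℝ (Fin d) → ℝ} (hg : LipschitzWith K g)
    (x y : EuclideanSpace ℝ (Fin d)) :
    |g (y - (inner ℝ ν y : ℝ) • ν) - g (x - (inner ℝ ν x : ℝ) • ν)| ≤ K * (2 * ‖y - x‖) := by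
  have h := hg.dist_le_mul (y - (inner ℝ ν y : ℝ) • ν) (x - (inner ℝ ν x : ℝ) • ν)
  rw [Real.dist_eq, dist_eq_norm] at h
  refine h.trans (mul_le_mul_of_nonneg_left ?_ K.2)
  have := norm_sub_inner_smul_le hν (y - x)
  rwa [inner_sub_right, sub_smul, sub_sub_sub_comm] at this

lemma exists_nhds_exists_ball_subset (hΩ : IsOpen Ω) (hlip : HasLipschitzBoundary Ω)
    {p : EuclideanSpace ℝ (Fin d)} (hp : p ∈ closure Ω) :
    ∃ U ∈ nhds p, ∃ κ s₀ : ℝ, 0 < κ ∧ 0 < s₀ ∧ ∀ x ∈ Ω ∩ U, ∀ s, 0 < s → s ≤ s₀ →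
      ∃ y, Metric.ball y (κ * s) ⊆ Ω ∩ Metric.ball x s := by
  by_cases hpΩ : p ∈ Ω
  · obtain ⟨ε, hε, hsub⟩ := Metric.isOpen_iff.1 hΩ p hpΩ
    refine ⟨Metric.ball p (ε / 2), Metric.ball_mem_nhds _ (by linarith), 1, ε / 2, one_pos,
      by linarith, fun x hx s hs hs0 => ⟨x, ?_⟩⟩
    rw [one_mul]
    refine Set.subset_inter (fun y hy => hsub ?_) subset_rfl
    have h1 := Metric.mem_ball.1 hx.2
    have h2 := Metric.mem_ball.1 hy
    exact Metric.mem_ball.2 (by linarith [dist_triangle y x p])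
  · have hfr : p ∈ frontier Ω := by rw [hΩ.frontier_eq]; exact ⟨hp, hpΩ⟩
    obtain ⟨ν, R, K, g, hν, hR, hg, hiff⟩ := hlip p hfr
    have hK : (0 : ℝ) ≤ K := K.2
    have hκ : (0 : ℝ) < 1 / (4 * (K + 1)) := by positivity
    refine ⟨Metric.ball p (R / 2), Metric.ball_mem_nhds _ (by linarith), 1 / (4 * (K + 1)), R / 2,
      hκ, by linarith, fun x hx s hs hs0 => ⟨x + (s / 2) • ν, fun y hy => ?_⟩⟩
    set κ : ℝ := 1 / (4 * (K + 1)) with hκd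
    have hκK : κ * (4 * (K + 1)) = 1 := by rw [hκd]; field_simp
    set w := y - (x + (s / 2) • ν) with hw
    have hwn : ‖w‖ < κ * s := by rw [hw, ← dist_eq_norm]; exact hy
    have hyx : y - x = (s / 2) • ν + w := by rw [hw]; abel
    have hnorm : ‖y - x‖ < s := by
      rw [hyx]
      have := norm_add_le ((s / 2) • ν) w
      rw [norm_smul, hν, Real.norm_eq_abs, abs_of_pos (by linarith : 0 < s / 2)] at this
      nlinarith
    have hyb : y ∈ Metric.ball x s := by rw [Metric.mem_ball, dist_eq_norm]; exact hnorm
    have hx2 := Metric.mem_ball.1 hx.2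
    have hyR : y ∈ Metric.ball p R := by
      have := Metric.mem_ball.1 hyb
      exact Metric.mem_ball.2 (by linarith [dist_triangle y x p])
    have hxR : x ∈ Metric.ball p R := Metric.mem_ball.2 (by linarith)
    refine ⟨(hiff y hyR).2 ?_, hyb⟩
    have hgx := (hiff x hxR).1 hx.1
    have hiy : (inner ℝ ν y : ℝ) = inner ℝ ν x + s / 2 + inner ℝ ν w := by
      have : y = x + ((s / 2) • ν + w) := by rw [← hyx]; abel
      conv_lhs => rw [this]
      rw [inner_add_right, inner_add_right, real_inner_smul_right, real_inner_self_eq_norm_sq, hν]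
      ring
    -- moving along `ν` does not change the projection to `ν^⊥`
    have hproj : y - (inner ℝ ν y : ℝ) • ν =
        (x + w) - (inner ℝ ν (x + w) : ℝ) • ν := by
      rw [hiy, inner_add_right, eq_add_of_sub_eq' hyx]
      module
    have hgl := abs_comp_proj_sub_le hν hg x (x + w)
    rw [← hproj, add_sub_cancel_left] at hgl
    have hiw := (abs_le.1 (abs_real_inner_le_norm ν w)).1
    rw [hν, one_mul] at hiw
    have h3 := (abs_le.1 hgl).2
    have h4 := mul_le_mul_of_nonneg_left hwn.le hK
    have h5 : 4 * (K * (κ * s)) + 4 * (κ * s) = s := by linear_combination s * hκK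
    have h6 : 0 < κ * s := mul_pos hκ hs
    linarith

/-- The interior cone property, as a measure density statement: every small ball centred in a
bounded Lipschitz domain contains a ball of comparable radius inside the domain. -/
lemma exists_ball_subset (hΩ : IsOpen Ω) (hb : Bornology.IsBounded Ω)
    (hlip : HasLipschitzBoundary Ω) :
    ∃ κ s₀ : ℝ, 0 < κ ∧ 0 < s₀ ∧ ∀ x ∈ Ω, ∀ s, 0 < s → s ≤ s₀ →
      ∃ y, Metric.ball y (κ * s) ⊆ Ω ∩ Metric.ball x s := by
  have hc : IsCompact (closure Ω) := hb.isCompact_closure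
  suffices H : ∃ κ s₀ : ℝ, 0 < κ ∧ 0 < s₀ ∧ ∀ x ∈ Ω ∩ closure Ω, ∀ s, 0 < s → s ≤ s₀ →
      ∃ y, Metric.ball y (κ * s) ⊆ Ω ∩ Metric.ball x s by
    rwa [Set.inter_eq_left.2 subset_closure] at H
  refine hc.induction_on (p := fun S => ∃ κ s₀ : ℝ, 0 < κ ∧ 0 < s₀ ∧ ∀ x ∈ Ω ∩ S, ∀ s, 0 < s →
    s ≤ s₀ → ∃ y, Metric.ball y (κ * s) ⊆ Ω ∩ Metric.ball x s) ?_ ?_ ?_ ?_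
  · exact ⟨1, 1, one_pos, one_pos, fun x hx => hx.2.elim⟩
  · rintro S S' hSS ⟨κ, s₀, hκ, hs₀, h⟩
    exact ⟨κ, s₀, hκ, hs₀, fun x hx => h x ⟨hx.1, hSS hx.2⟩⟩
  · rintro S S' ⟨κ, s₀, hκ, hs₀, h⟩ ⟨κ', s₀', hκ', hs₀', h'⟩
    refine ⟨min κ κ', min s₀ s₀', lt_min hκ hκ', lt_min hs₀ hs₀', ?_⟩
    rintro x ⟨hx, hxS | hxS⟩ s hs hss
    · obtain ⟨y, hy⟩ := h x ⟨hx, hxS⟩ s hs (hss.trans (min_le_left _ _))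
      exact ⟨y, (Metric.ball_subset_ball
        (mul_le_mul_of_nonneg_right (min_le_left _ _) hs.le)).trans hy⟩
    · obtain ⟨y, hy⟩ := h' x ⟨hx, hxS⟩ s hs (hss.trans (min_le_right _ _))
      exact ⟨y, (Metric.ball_subset_ball
        (mul_le_mul_of_nonneg_right (min_le_right _ _) hs.le)).trans hy⟩
  · intro p hp
    obtain ⟨U, hU, h⟩ := exists_nhds_exists_ball_subset hΩ hlip hp
    exact ⟨U, mem_nhdsWithin_of_mem_nhds hU, h⟩

/-- The slab of height `τ` above a graph over `ν^⊥` has volume `O(τ)`: about `1 / τ` of its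
translates by multiples of `τ • ν` are disjoint and lie in a fixed ball. -/
lemma volume_slab_le {ν : EuclideanSpace ℝ (Fin d)} (hν : ‖ν‖ = 1)
    {g : EuclideanSpace ℝ (Fin d) → ℝ} (hg : Continuous g) (p : EuclideanSpace ℝ (Fin d))
    (R : ℝ) {τ : ℝ} (hτ : 0 < τ) (hτ1 : τ ≤ 1) :
    volume {x | x ∈ Metric.ball p R ∧ 0 < (inner ℝ ν x : ℝ) - g (x - (inner ℝ ν x : ℝ) • ν) ∧
        (inner ℝ ν x : ℝ) - g (x - (inner ℝ ν x : ℝ) • ν) ≤ τ} ≤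
      ENNReal.ofReal τ * volume (Metric.ball p (R + 2)) := by
  set u : EuclideanSpace ℝ (Fin d) → ℝ :=
    fun x => (inner ℝ ν x : ℝ) - g (x - (inner ℝ ν x : ℝ) • ν) with hu
  have huc : Continuous u := by rw [hu]; fun_prop
  have hut : ∀ x (a : ℝ), u (x + a • ν) = u x + a := by
    intro x a
    have h1 : (inner ℝ ν (x + a • ν) : ℝ) = inner ℝ ν x + a := by
      rw [inner_add_right, real_inner_smul_right, real_inner_self_eq_norm_sq, hν]; ring
    have h2 : x + a • ν - (inner ℝ ν x + a : ℝ) • ν = x - (inner ℝ ν x : ℝ) • ν := by module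
    simp only [hu, h1, h2]
    ring
  set S : Set (EuclideanSpace ℝ (Fin d)) := {x | x ∈ Metric.ball p R ∧ 0 < u x ∧ u x ≤ τ} with hS
  have hSm : MeasurableSet S :=
    Metric.isOpen_ball.measurableSet.inter
      ((measurableSet_lt measurable_const huc.measurable).inter
        (measurableSet_le huc.measurable measurable_const))
  set J := ⌈1 / τ⌉₊ with hJ
  have hJ1 : 1 ≤ τ * J := by
    have := Nat.le_ceil (1 / τ)
    rw [div_le_iff₀ hτ] at this
    linarith
  have hJ2 : (J : ℝ) * τ ≤ 2 := by
    have := (Nat.ceil_lt_add_one (by positivity : 0 ≤ 1 / τ)).le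
    calc (J : ℝ) * τ ≤ (1 / τ + 1) * τ := by gcongr
      _ = 1 + τ := by field_simp
      _ ≤ 2 := by linarith
  let A : ℕ → Set (EuclideanSpace ℝ (Fin d)) := fun j => (fun x => x + (-((j : ℝ) * τ)) • ν) ⁻¹' S
  have hAm : ∀ j, MeasurableSet (A j) := fun j => (measurable_add_const _) hSm
  have hAv : ∀ j, volume (A j) = volume S := fun j => measure_preimage_add_right _ _ _
  have hdisj : Set.PairwiseDisjoint (↑(Finset.range J)) A := by
    intro i _ j _ hij
    rw [Function.onFun, Set.disjoint_left]
    rintro x ⟨-, hi1, hi2⟩ ⟨-, hj1, hj2⟩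
    rw [hut] at hi1 hi2 hj1 hj2
    apply hij
    have hle : ∀ a b : ℕ, 0 < u x + -((a : ℝ) * τ) → u x + -((b : ℝ) * τ) ≤ τ → a ≤ b := by
      intro a b ha hb
      have : (a : ℝ) * τ < (b + 1) * τ := by linarith
      have h' : (a : ℝ) < b + 1 := lt_of_mul_lt_mul_right this hτ.le
      exact Nat.lt_succ_iff.1 (by exact_mod_cast h')
    exact le_antisymm (hle i j hi1 hj2) (hle j i hj1 hi2)
  have hsub : (⋃ j ∈ Finset.range J, A j) ⊆ Metric.ball p (R + 2) := by
    intro x hx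
    simp only [Set.mem_iUnion, Finset.mem_range] at hx
    obtain ⟨j, hj, hxj, -⟩ := hx
    have hjJ : (j : ℝ) * τ ≤ 2 := by
      have : (j : ℝ) ≤ J := by exact_mod_cast hj.le
      nlinarith
    have h1 := Metric.mem_ball.1 hxj
    have h2 : dist x (x + (-((j : ℝ) * τ)) • ν) ≤ 2 := by
      rw [dist_eq_norm, sub_add_cancel_left, norm_neg, norm_smul, hν, Real.norm_eq_abs, abs_neg,
        abs_of_nonneg (by positivity)]
      linarith
    exact Metric.mem_ball.2 (by linarith [dist_triangle x (x + (-((j : ℝ) * τ)) • ν) p])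
  have hcount : (J : ℝ≥0∞) * volume S ≤ volume (Metric.ball p (R + 2)) := by
    have := measure_biUnion_finset hdisj (fun j _ => hAm j) (μ := volume)
    simp only [hAv, Finset.sum_const, Finset.card_range, nsmul_eq_mul] at this
    rw [← this]
    exact measure_mono hsub
  have hone : 1 ≤ ENNReal.ofReal τ * (J : ℝ≥0∞) := by
    rw [← ENNReal.ofReal_natCast, ← ENNReal.ofReal_mul hτ.le]
    exact ENNReal.one_le_ofReal.2 hJ1
  calc volume S = 1 * volume S := (one_mul _).symm
    _ ≤ ENNReal.ofReal τ * J * volume S := by gcongr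
    _ = ENNReal.ofReal τ * (J * volume S) := mul_assoc _ _ _
    _ ≤ _ := by gcongr

lemma exists_nhds_volume_layer_le (hΩ : IsOpen Ω) (hne : Ωᶜ.Nonempty)
    (hlip : HasLipschitzBoundary Ω) {p : EuclideanSpace ℝ (Fin d)} (hp : p ∈ closure Ω) :
    ∃ U ∈ nhds p, ∃ C s₀ : ℝ, 0 ≤ C ∧ 0 < s₀ ∧ ∀ s, 0 < s → s ≤ s₀ →
      volume {x | x ∈ Ω ∩ U ∧ Metric.infDist x Ωᶜ < s} ≤ ENNReal.ofReal (C * s) := by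
  by_cases hpΩ : p ∈ Ω
  · obtain ⟨ε, hε, hsub⟩ := Metric.isOpen_iff.1 hΩ p hpΩ
    refine ⟨Metric.ball p (ε / 2), Metric.ball_mem_nhds _ (by linarith), 0, ε / 2, le_rfl,
      by linarith, fun s hs hs0 => ?_⟩
    have : {x | x ∈ Ω ∩ Metric.ball p (ε / 2) ∧ Metric.infDist x Ωᶜ < s} = ∅ := by
      refine Set.eq_empty_iff_forall_notMem.2 ?_
      rintro x ⟨⟨-, hx⟩, hxs⟩
      obtain ⟨q, hq, hxq⟩ := (Metric.infDist_lt_iff hne).1 hxs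
      refine hq (hsub (Metric.mem_ball.2 ?_))
      have := Metric.mem_ball.1 hx
      have h3 := dist_triangle q x p
      rw [dist_comm q x] at h3
      linarith
    rw [this]; simp
  · have hfr : p ∈ frontier Ω := by rw [hΩ.frontier_eq]; exact ⟨hp, hpΩ⟩
    obtain ⟨ν, R, K, g, hν, hR, hg, hiff⟩ := hlip p hfr
    have hK : (0 : ℝ) ≤ K := K.2
    set W := volume (Metric.ball p (R + 2)) with hW
    have hWt : W ≠ ⊤ := measure_ball_lt_top.ne
    refine ⟨Metric.ball p (R / 2), Metric.ball_mem_nhds _ (by linarith), (2 * K + 1) * W.toReal,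
      min (R / 2) (1 / (2 * K + 1)), by positivity, by positivity, fun s hs hs0 => ?_⟩
    have hsR : s ≤ R / 2 := hs0.trans (min_le_left _ _)
    have hs1 : (2 * K + 1) * s ≤ 1 := by
      have := hs0.trans (min_le_right _ _)
      rw [le_div_iff₀ (by positivity)] at this
      linarith
    have hsub : {x | x ∈ Ω ∩ Metric.ball p (R / 2) ∧ Metric.infDist x Ωᶜ < s} ⊆
        {x | x ∈ Metric.ball p R ∧ 0 < (inner ℝ ν x : ℝ) - g (x - (inner ℝ ν x : ℝ) • ν) ∧
        (inner ℝ ν x : ℝ) - g (x - (inner ℝ ν x : ℝ) • ν) ≤ (2 * K + 1) * s} := by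
      rintro x ⟨⟨hxΩ, hx⟩, hxs⟩
      obtain ⟨q, hq, hxq⟩ := (Metric.infDist_lt_iff hne).1 hxs
      have h1 := Metric.mem_ball.1 hx
      have hxR : x ∈ Metric.ball p R := Metric.mem_ball.2 (by linarith)
      have hqR : q ∈ Metric.ball p R := by
        have h3 := dist_triangle q x p
        rw [dist_comm q x] at h3
        exact Metric.mem_ball.2 (by linarith)
      have hgx := (hiff x hxR).1 hxΩ
      have hgq := not_lt.1 (mt (hiff q hqR).2 hq)
      have hl := (abs_le.1 (abs_comp_proj_sub_le hν hg x q)).2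
      rw [← dist_eq_norm, dist_comm] at hl
      have hi := (abs_le.1 (abs_real_inner_le_norm ν (x - q))).2
      rw [hν, one_mul, inner_sub_right, ← dist_eq_norm] at hi
      refine ⟨hxR, by linarith, ?_⟩
      nlinarith [mul_le_mul_of_nonneg_left hxq.le hK]
    calc _ ≤ _ := measure_mono hsub
      _ ≤ ENNReal.ofReal ((2 * K + 1) * s) * W :=
        volume_slab_le hν hg.continuous p R (by positivity) hs1
      _ = ENNReal.ofReal ((2 * K + 1) * W.toReal * s) := by
        rw [← ENNReal.ofReal_toReal hWt, ← ENNReal.ofReal_mul (by positivity),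
          ENNReal.toReal_ofReal ENNReal.toReal_nonneg]
        congr 1; ring

/-- The boundary layer of width `s` of a bounded Lipschitz domain has volume `O(s)`. -/
lemma exists_volume_layer_le (hΩ : IsOpen Ω) (hb : Bornology.IsBounded Ω) (hne : Ωᶜ.Nonempty)
    (hlip : HasLipschitzBoundary Ω) :
    ∃ C : ℝ, 0 ≤ C ∧ ∀ s, 0 < s →
      volume {x | x ∈ Ω ∧ Metric.infDist x Ωᶜ < s} ≤ ENNReal.ofReal (C * s) := by
  have hc : IsCompact (closure Ω) := hb.isCompact_closure
  have H : ∃ C s₀ : ℝ, 0 ≤ C ∧ 0 < s₀ ∧ ∀ s, 0 < s → s ≤ s₀ →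
      volume {x | x ∈ Ω ∩ closure Ω ∧ Metric.infDist x Ωᶜ < s} ≤ ENNReal.ofReal (C * s) := by
    refine hc.induction_on (p := fun S => ∃ C s₀ : ℝ, 0 ≤ C ∧ 0 < s₀ ∧ ∀ s, 0 < s → s ≤ s₀ →
      volume {x | x ∈ Ω ∩ S ∧ Metric.infDist x Ωᶜ < s} ≤ ENNReal.ofReal (C * s)) ?_ ?_ ?_ ?_
    · exact ⟨0, 1, le_rfl, one_pos, fun s _ _ => by simp⟩
    · rintro S S' hSS ⟨C, s₀, hC, hs₀, h⟩
      exact ⟨C, s₀, hC, hs₀, fun s hs hs0 =>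
        (measure_mono (by rintro x ⟨⟨h1, h2⟩, h3⟩; exact ⟨⟨h1, hSS h2⟩, h3⟩)).trans
          (h s hs hs0)⟩
    · rintro S S' ⟨C, s₀, hC, hs₀, h⟩ ⟨C', s₀', hC', hs₀', h'⟩
      refine ⟨C + C', min s₀ s₀', by positivity, lt_min hs₀ hs₀', fun s hs hss => ?_⟩
      calc _ ≤ volume ({x | x ∈ Ω ∩ S ∧ Metric.infDist x Ωᶜ < s} ∪
            {x | x ∈ Ω ∩ S' ∧ Metric.infDist x Ωᶜ < s}) := by
            refine measure_mono ?_
            rintro x ⟨⟨hx, hxS | hxS⟩, hxs⟩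
            · exact Or.inl ⟨⟨hx, hxS⟩, hxs⟩
            · exact Or.inr ⟨⟨hx, hxS⟩, hxs⟩
        _ ≤ _ := measure_union_le _ _
        _ ≤ ENNReal.ofReal (C * s) + ENNReal.ofReal (C' * s) :=
            add_le_add (h s hs (hss.trans (min_le_left _ _)))
              (h' s hs (hss.trans (min_le_right _ _)))
        _ = ENNReal.ofReal ((C + C') * s) := by
            rw [← ENNReal.ofReal_add (by positivity) (by positivity), add_mul]
    · intro p hp
      obtain ⟨U, hU, h⟩ := exists_nhds_volume_layer_le hΩ hne hlip hp
      exact ⟨U, mem_nhdsWithin_of_mem_nhds hU, h⟩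
  rw [Set.inter_eq_left.2 subset_closure] at H
  obtain ⟨C, s₀, hC, hs₀, h⟩ := H
  have hΩt : volume Ω ≠ ⊤ := hb.measure_lt_top.ne
  refine ⟨C + (volume Ω).toReal / s₀, by positivity, fun s hs => ?_⟩
  rcases le_or_gt s s₀ with hss | hss
  · refine (h s hs hss).trans (ENNReal.ofReal_le_ofReal ?_)
    gcongr
    exact le_add_of_nonneg_right (by positivity)
  · calc _ ≤ volume Ω := measure_mono fun x hx => hx.1
      _ = ENNReal.ofReal (volume Ω).toReal := (ENNReal.ofReal_toReal hΩt).symm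
      _ ≤ _ := by
        refine ENNReal.ofReal_le_ofReal ?_
        have h1 : 1 ≤ s / s₀ := (one_le_div hs₀).2 hss.le
        have h2 : (volume Ω).toReal * 1 ≤ (volume Ω).toReal * (s / s₀) := by gcongr
        have h3 : (volume Ω).toReal / s₀ * s = (volume Ω).toReal * (s / s₀) := by ring
        rw [add_mul, h3]
        have : 0 ≤ C * s := by positivity
        linarith

/-- The boundary weight `min 1 (h / dist(x, Ωᶜ))²`: it bounds the fraction of the kernel of width
`h` at `x` that falls outside `Ω`. -/
noncomputable def layerWeight (Ω : Set (EuclideanSpace ℝ (Fin d))) (h : ℝ)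
    (x : EuclideanSpace ℝ (Fin d)) : ℝ :=
  min 1 ((h / Metric.infDist x Ωᶜ) ^ 2)

lemma layerWeight_nonneg (h : ℝ) (x : EuclideanSpace ℝ (Fin d)) : 0 ≤ layerWeight Ω h x :=
  le_min zero_le_one (sq_nonneg _)

lemma layerWeight_le_one (h : ℝ) (x : EuclideanSpace ℝ (Fin d)) : layerWeight Ω h x ≤ 1 :=
  min_le_left _ _

lemma measurable_layerWeight (h : ℝ) : Measurable (layerWeight Ω h) :=
  measurable_const.min
    ((measurable_const.div (Metric.continuous_infDist_pt _).measurable).pow_const 2)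

/-- Layer-cake integration of `layerWeight` against the volume bound for boundary layers. -/
lemma setIntegral_layerWeight_le (hΩ : IsOpen Ω) (hne : Ωᶜ.Nonempty) {C : ℝ} (hC : 0 ≤ C)
    (hlayer : ∀ s, 0 < s →
      volume {x | x ∈ Ω ∧ Metric.infDist x Ωᶜ < s} ≤ ENNReal.ofReal (C * s))
    {h : ℝ} (hh : 0 < h) :
    ∫ x in Ω, layerWeight Ω h x ≤ 2 * C * h := by
  have hint : IntervalIntegrable (fun t : ℝ => C * h * t ^ (-(1 / 2) : ℝ)) volume 0 1 :=
    (intervalIntegral.intervalIntegrable_rpow' (by norm_num)).const_mul _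
  have hbound : ∀ t ∈ Set.Ioi (0 : ℝ), (volume.restrict Ω) {x | t < layerWeight Ω h x} ≤
      (Set.Ioc (0 : ℝ) 1).indicator (fun t => ENNReal.ofReal (C * h * t ^ (-(1 / 2) : ℝ))) t := by
    intro t ht
    have ht0 : 0 < t := ht
    rw [Measure.restrict_apply' hΩ.measurableSet]
    by_cases ht1 : t ≤ 1
    · rw [Set.indicator_of_mem (show t ∈ Set.Ioc (0 : ℝ) 1 from ⟨ht0, ht1⟩)]
      have hsq : 0 < t ^ (1 / 2 : ℝ) := Real.rpow_pos_of_pos ht0 _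
      have hsq2 : (t ^ (1 / 2 : ℝ)) ^ 2 = t := by
        rw [← Real.rpow_natCast, ← Real.rpow_mul ht0.le]; norm_num
      refine (measure_mono ?_).trans ((hlayer (h * t ^ (-(1 / 2) : ℝ)) (by positivity)).trans
        (ENNReal.ofReal_le_ofReal (by rw [mul_assoc])))
      rintro x ⟨hx, hxΩ⟩
      refine ⟨hxΩ, ?_⟩
      have hx2 : t < (h / Metric.infDist x Ωᶜ) ^ 2 := (lt_min_iff.1 hx).2
      have hδ : 0 < Metric.infDist x Ωᶜ :=
        (hΩ.isClosed_compl.notMem_iff_infDist_pos hne).1 (fun hc => hc hxΩ)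
      rw [← hsq2] at hx2
      have hx3 := lt_of_pow_lt_pow_left₀ 2 (by positivity) hx2
      rw [lt_div_iff₀ hδ] at hx3
      rw [Real.rpow_neg ht0.le, ← div_eq_mul_inv, lt_div_iff₀ hsq]
      linarith
    · have : {x | t < layerWeight Ω h x} = ∅ := by
        refine Set.eq_empty_iff_forall_notMem.2 fun x hx => ht1 ?_
        exact (le_of_lt hx).trans (layerWeight_le_one h x)
      simp [this]
  have hlin : ∫⁻ x in Ω, ENNReal.ofReal (layerWeight Ω h x) ≤ ENNReal.ofReal (2 * C * h) := by
    rw [lintegral_eq_lintegral_meas_lt _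
      (Filter.Eventually.of_forall fun x => layerWeight_nonneg h x)
      (measurable_layerWeight h).aemeasurable]
    refine (setLIntegral_mono' measurableSet_Ioi hbound).trans ?_
    refine (setLIntegral_le_lintegral _ _).trans ?_
    rw [lintegral_indicator measurableSet_Ioc, ← ofReal_integral_eq_lintegral_ofReal]
    · rw [← intervalIntegral.integral_of_le zero_le_one, intervalIntegral.integral_const_mul,
        integral_rpow (Or.inl (by norm_num))]
      refine ENNReal.ofReal_le_ofReal (le_of_eq ?_)
      norm_num
      ring
    · exact (intervalIntegrable_iff_integrableOn_Ioc_of_le zero_le_one).1 hint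
    · refine (ae_restrict_iff' measurableSet_Ioc).2 (Filter.Eventually.of_forall fun t ht => ?_)
      have : 0 < t := ht.1
      simp only [Pi.zero_apply]
      positivity
  rw [integral_eq_lintegral_of_nonneg_ae
    (Filter.Eventually.of_forall fun x => layerWeight_nonneg h x)
    (measurable_layerWeight h).aestronglyMeasurable]
  exact ENNReal.toReal_le_of_le_ofReal (by positivity) hlin

end Geometry

/-! ### The graph kernel -/

section GraphKernel

variable {d : ℕ} {η : ℝ → ℝ}

/-- The polynomial moment `∫ η(|z|) (1 + |z|)⁴ dz`, which dominates the mass and the moments of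
orders `1, …, 4`. -/
noncomputable def polyMoment (d : ℕ) (η : ℝ → ℝ) : ℝ :=
  ∫ z : EuclideanSpace ℝ (Fin d), η ‖z‖ * (1 + ‖z‖) ^ 4

lemma IsGraphKernel.eta_nonneg (hη : IsGraphKernel d η) {E : Type*} [SeminormedAddCommGroup E]
    (z : E) : 0 ≤ η ‖z‖ :=
  hη.nonneg _ (norm_nonneg _)

lemma IsGraphKernel.measurable_comp (hη : IsGraphKernel d η) {α : Type*} [MeasurableSpace α]
    {f : α → ℝ} (hf : Measurable f) (h0 : ∀ x, 0 ≤ f x) : Measurable fun x => η (f x) := by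
  have hanti : Antitone fun t => η (max t 0) := fun a b hab =>
    hη.antitone (le_max_right a 0) (le_max_right b 0) (max_le_max_right 0 hab)
  have := hanti.measurable.comp hf
  simpa only [Function.comp_def, max_eq_left (h0 _)] using this

lemma IsGraphKernel.measurable_eta_norm (hη : IsGraphKernel d η) :
    Measurable fun z : EuclideanSpace ℝ (Fin d) => η ‖z‖ :=
  hη.measurable_comp measurable_norm fun _ => norm_nonneg _

lemma IsGraphKernel.integrable (hη : IsGraphKernel d η) :
    Integrable fun z : EuclideanSpace ℝ (Fin d) => η ‖z‖ := by
  by_contra h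
  have := hη.mass_one
  rw [integral_undef h] at this
  exact zero_ne_one this

lemma IsGraphKernel.integrable_poly (hη : IsGraphKernel d η) :
    Integrable fun z : EuclideanSpace ℝ (Fin d) => η ‖z‖ * (1 + ‖z‖) ^ 4 := by
  have h0 := hη.integrable
  have h1 := hη.moments 1 (by simp)
  have h2 := hη.moments 2 (by simp)
  have h3 := hη.moments 3 (by simp)
  have h4 := hη.moments 4 (by simp)
  refine ((((h0.add (h1.const_mul 4)).add (h2.const_mul 6)).add (h3.const_mul 4)).add h4).congr
    (Filter.Eventually.of_forall fun z => ?_)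
  simp only [Pi.add_apply]
  ring

lemma IsGraphKernel.polyMoment_nonneg (hη : IsGraphKernel d η) : 0 ≤ polyMoment d η :=
  integral_nonneg fun z => mul_nonneg (hη.eta_nonneg z) (by positivity)

lemma IsGraphKernel.exists_pos [NeZero d] (hη : IsGraphKernel d η) : ∃ t > 0, 0 < η t := by
  by_contra! h
  have h0 : (fun z : EuclideanSpace ℝ (Fin d) => η ‖z‖) =ᵐ[volume] fun _ => 0 := by
    have : ∀ᵐ z : EuclideanSpace ℝ (Fin d), z ≠ 0 := by
      rw [ae_iff]; simp
    filter_upwards [this] with z hz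
    exact le_antisymm (h _ (norm_pos_iff.2 hz)) (hη.eta_nonneg z)
  have := hη.mass_one
  rw [integral_congr_ae h0] at this
  simp at this

/-- A decreasing kernel with finite second moment decays at least like `t⁻²`: on a ball of radius
`1 / 2` inside `{t - 1 ≤ |z| ≤ t}` the integrand of the second moment is at least
`η(t) t² / 4`. -/
lemma IsGraphKernel.exists_le [NeZero d] (hη : IsGraphKernel d η) :
    ∃ B : ℝ, 0 ≤ B ∧ ∀ t, 0 ≤ t → η t * (1 + t ^ 2) ≤ B := by
  have h2 := hη.moments 2 (by simp)
  set m₂ := ∫ z : EuclideanSpace ℝ (Fin d), η ‖z‖ * ‖z‖ ^ 2 with hm₂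
  set v := (volume : Measure (EuclideanSpace ℝ (Fin d))).real (Metric.ball 0 (1 / 2)) with hv
  have hvpos : 0 < v := ENNReal.toReal_pos (Metric.measure_ball_pos _ _ (by norm_num)).ne'
    measure_ball_lt_top.ne
  have hm0 : 0 ≤ m₂ := integral_nonneg fun z => mul_nonneg (hη.eta_nonneg z) (by positivity)
  have hle0 : ∀ t, 0 ≤ t → η t ≤ η 0 := fun t ht => hη.antitone Set.self_mem_Ici ht ht
  refine ⟨5 * η 0 + 4 * m₂ / v, by have := hη.zero_pos; positivity, fun t ht => ?_⟩
  have hηt := hη.nonneg t ht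
  rcases le_or_gt t 2 with ht2 | ht2
  · have h5 : 1 + t ^ 2 ≤ 5 := by nlinarith
    calc η t * (1 + t ^ 2) ≤ η 0 * 5 :=
          mul_le_mul (hle0 t ht) h5 (by positivity) hη.zero_pos.le
      _ ≤ _ := by have : 0 ≤ 4 * m₂ / v := by positivity
                  linarith
  · obtain ⟨e, he⟩ := exists_norm_eq (EuclideanSpace ℝ (Fin d)) zero_le_one
    set c := (t - 1 / 2) • e with hc
    have hcn : ‖c‖ = t - 1 / 2 := by
      rw [hc, norm_smul, he, Real.norm_eq_abs, abs_of_pos (by linarith)]; ring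
    have hlow : ∀ z ∈ Metric.ball c (1 / 2), η t * (t ^ 2 / 4) ≤ η ‖z‖ * ‖z‖ ^ 2 := by
      intro z hz
      have hz' : ‖z - c‖ < 1 / 2 := by rw [← dist_eq_norm]; exact hz
      have h3 := abs_le.1 (abs_norm_sub_norm_le z c)
      have hzt : ‖z‖ ≤ t := by linarith [h3.2]
      have hzt2 : t / 2 ≤ ‖z‖ := by linarith [h3.1]
      have h6 : η t ≤ η ‖z‖ := hη.antitone (norm_nonneg z) ht hzt
      have h7 : t ^ 2 / 4 ≤ ‖z‖ ^ 2 := by nlinarith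
      exact mul_le_mul h6 h7 (by positivity) (hη.eta_nonneg z)
    have hint : η t * (t ^ 2 / 4) * v ≤ m₂ := by
      have hvc : v = (volume : Measure (EuclideanSpace ℝ (Fin d))).real (Metric.ball c (1 / 2)) := by
        rw [hv, measureReal_def, measureReal_def, Measure.addHaar_ball_center volume c]
      rw [hvc]
      refine (setIntegral_ge_of_const_le_real measurableSet_ball measure_ball_lt_top.ne hlow
        h2.integrableOn).trans ?_
      exact setIntegral_le_integral h2
        (Filter.Eventually.of_forall fun z => mul_nonneg (hη.eta_nonneg z) (by positivity))
    have h8 : η t * t ^ 2 ≤ 4 * m₂ / v := by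
      rw [le_div_iff₀ hvpos]; linarith
    have := hle0 t ht
    have := hη.zero_pos
    linarith

lemma IsGraphKernel.kernel_nonneg (hη : IsGraphKernel d η) {s : ℝ} (hs : 0 < s) {t : ℝ}
    (ht : 0 ≤ t) : 0 ≤ kernel d η s t :=
  mul_nonneg (by positivity) (hη.nonneg _ (by positivity))

lemma IsGraphKernel.kernel_le (hη : IsGraphKernel d η) {s : ℝ} (hs : 0 < s) {t : ℝ}
    (ht : 0 ≤ t) : kernel d η s t ≤ (s ^ d)⁻¹ * η 0 :=
  mul_le_mul_of_nonneg_left (hη.antitone Set.self_mem_Ici (by positivity : 0 ≤ t / s)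
    (by positivity)) (by positivity)

lemma IsGraphKernel.measurable_kernel (hη : IsGraphKernel d η) {s : ℝ} (hs : 0 < s)
    (x : EuclideanSpace ℝ (Fin d)) : Measurable fun y => kernel d η s ‖x - y‖ :=
  (hη.measurable_comp (f := fun y => ‖x - y‖ / s) (by fun_prop) fun y => by positivity).const_mul _

/-- Rescaling `y = x + s z` in an integral against the kernel of width `s`. -/
lemma integral_kernel_mul {s : ℝ} (hs : 0 < s) (x : EuclideanSpace ℝ (Fin d))
    (G : EuclideanSpace ℝ (Fin d) → ℝ) :
    ∫ y, kernel d η s ‖x - y‖ * G y = ∫ z : EuclideanSpace ℝ (Fin d), η ‖z‖ * G (x + s • z) := by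
  have h1 := Measure.integral_comp_smul volume
    (fun u : EuclideanSpace ℝ (Fin d) => η (‖u‖ / s) * G (x + u)) s
  rw [finrank_euclideanSpace_fin, abs_of_pos (by positivity), smul_eq_mul] at h1
  have h2 := integral_add_left_eq_self (μ := volume)
    (fun y : EuclideanSpace ℝ (Fin d) => kernel d η s ‖x - y‖ * G y) x
  rw [← h2]
  simp only [kernel, sub_add_cancel_left, norm_neg, mul_assoc]
  rw [integral_const_mul, ← h1]
  refine integral_congr_ae (Filter.Eventually.of_forall fun z => ?_)
  simp only
  rw [norm_smul, Real.norm_eq_abs, abs_of_pos hs, mul_div_cancel_left₀ _ hs.ne']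

lemma setIntegral_kernel_mul {Ω : Set (EuclideanSpace ℝ (Fin d))} (hΩ : MeasurableSet Ω) {s : ℝ}
    (hs : 0 < s) (x : EuclideanSpace ℝ (Fin d)) (q : EuclideanSpace ℝ (Fin d) → ℝ) :
    ∫ y in Ω, kernel d η s ‖x - y‖ * q y =
      ∫ z : EuclideanSpace ℝ (Fin d), η ‖z‖ * Ω.indicator q (x + s • z) := by
  rw [← integral_kernel_mul hs x, ← integral_indicator hΩ]
  congr 1
  ext y
  by_cases hy : y ∈ Ω <;> simp [hy]

lemma IsGraphKernel.abs_integral_le (hη : IsGraphKernel d η) {f : EuclideanSpace ℝ (Fin d) → ℝ}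
    {β : ℝ} (hb : ∀ z, |f z| ≤ β * (1 + ‖z‖) ^ 4) :
    |∫ z : EuclideanSpace ℝ (Fin d), η ‖z‖ * f z| ≤ β * polyMoment d η := by
  have := norm_integral_le_of_norm_le (hη.integrable_poly.const_mul β)
    (f := fun z => η ‖z‖ * f z) (Filter.Eventually.of_forall fun z => by
      rw [Real.norm_eq_abs, abs_mul, abs_of_nonneg (hη.eta_nonneg z)]
      have := mul_le_mul_of_nonneg_left (hb z) (hη.eta_nonneg z)
      linarith)
  rwa [integral_const_mul] at this

lemma IsGraphKernel.integrable_mul (hη : IsGraphKernel d η) {f : EuclideanSpace ℝ (Fin d) → ℝ}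
    (hf : Measurable f) {β : ℝ} (hb : ∀ z, |f z| ≤ β * (1 + ‖z‖) ^ 4) :
    Integrable fun z : EuclideanSpace ℝ (Fin d) => η ‖z‖ * f z := by
  refine (hη.integrable_poly.const_mul β).mono'
    (hη.measurable_eta_norm.mul hf).aestronglyMeasurable (Filter.Eventually.of_forall fun z => ?_)
  rw [Real.norm_eq_abs, abs_mul, abs_of_nonneg (hη.eta_nonneg z)]
  have := mul_le_mul_of_nonneg_left (hb z) (hη.eta_nonneg z)
  linarith

/-- Comparison of a kernel average over `Ω` with its limit as the kernel width tends to zero, from a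
pointwise comparison in the rescaled variable. -/
lemma IsGraphKernel.abs_setIntegral_kernel_sub_le (hη : IsGraphKernel d η)
    {Ω : Set (EuclideanSpace ℝ (Fin d))} (hΩ : MeasurableSet Ω) {s : ℝ} (hs : 0 < s)
    (x : EuclideanSpace ℝ (Fin d)) {q e : EuclideanSpace ℝ (Fin d) → ℝ}
    (hq : Measurable (Ω.indicator q)) (he : Measurable e) {β B : ℝ}
    (hb : ∀ z, |Ω.indicator q (x + s • z) - e z| ≤ β * (1 + ‖z‖) ^ 4)
    (heB : ∀ z, |e z| ≤ B * (1 + ‖z‖) ^ 4) :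
    |(∫ y in Ω, kernel d η s ‖x - y‖ * q y) - ∫ z : EuclideanSpace ℝ (Fin d), η ‖z‖ * e z| ≤
      β * polyMoment d η := by
  have hqm : Measurable fun z => Ω.indicator q (x + s • z) :=
    hq.comp (measurable_const.add (measurable_id.const_smul s))
  have hqb : ∀ z, |Ω.indicator q (x + s • z)| ≤ (β + B) * (1 + ‖z‖) ^ 4 := fun z => by
    have := abs_sub_abs_le_abs_sub (Ω.indicator q (x + s • z)) (e z)
    linarith [hb z, heB z]
  rw [setIntegral_kernel_mul hΩ hs, ← integral_sub (hη.integrable_mul hqm hqb)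
    (hη.integrable_mul he heB)]
  simp_rw [← mul_sub]
  exact hη.abs_integral_le hb

lemma IsGraphKernel.abs_setIntegral_kernel_le (hη : IsGraphKernel d η)
    {Ω : Set (EuclideanSpace ℝ (Fin d))} (hΩ : MeasurableSet Ω) {s : ℝ} (hs : 0 < s)
    (x : EuclideanSpace ℝ (Fin d)) {q : EuclideanSpace ℝ (Fin d) → ℝ} {β : ℝ} (hβ : 0 ≤ β)
    (hb : ∀ z, x + s • z ∈ Ω → |q (x + s • z)| ≤ β * (1 + ‖z‖) ^ 4) :
    |∫ y in Ω, kernel d η s ‖x - y‖ * q y| ≤ β * polyMoment d η := by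
  rw [setIntegral_kernel_mul hΩ hs]
  refine hη.abs_integral_le fun z => ?_
  by_cases hz : x + s • z ∈ Ω
  · simpa [hz] using hb z hz
  · simp [hz]; positivity

end GraphKernel

/-! ### Nonlocal-to-local comparison at a fixed point -/

section Local

variable {d m : ℕ} {Ω : Set (EuclideanSpace ℝ (Fin d))} {ρ σ : EuclideanSpace ℝ (Fin d) → ℝ}
  {η : ℝ → ℝ} {ρmin ρmax σmin σmax : ℝ}
  {T : EuclideanSpace ℝ (Fin d) → EuclideanSpace ℝ (Fin m)} {L L' : ℝ≥0} {h : ℝ}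
  {x : EuclideanSpace ℝ (Fin d)}

/-- The expectation of `degree / n` given a data point at `x`, without the diagonal term. -/
noncomputable def meanDegree (Ω : Set (EuclideanSpace ℝ (Fin d)))
    (ρ : EuclideanSpace ℝ (Fin d) → ℝ) (η : ℝ → ℝ) (σ : EuclideanSpace ℝ (Fin d) → ℝ) (h : ℝ)
    (x : EuclideanSpace ℝ (Fin d)) : ℝ :=
  ∫ y in Ω, kernel d η (σ x * h) ‖x - y‖ * ρ y

/-- The logarithmic interaction `log(1 + h⁻² |T x - T y|²)` of two embedded points. -/
noncomputable def logInteraction (h : ℝ)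
    (T : EuclideanSpace ℝ (Fin d) → EuclideanSpace ℝ (Fin m))
    (x y : EuclideanSpace ℝ (Fin d)) : ℝ :=
  Real.log (1 + (h ^ 2)⁻¹ * ‖T x - T y‖ ^ 2)

/-- The nonlocal attraction at `x`: the kernel average of the logarithmic interaction, before
division by `meanDegree`. -/
noncomputable def meanAttraction (Ω : Set (EuclideanSpace ℝ (Fin d)))
    (ρ : EuclideanSpace ℝ (Fin d) → ℝ) (η : ℝ → ℝ) (σ : EuclideanSpace ℝ (Fin d) → ℝ) (h : ℝ)
    (T : EuclideanSpace ℝ (Fin d) → EuclideanSpace ℝ (Fin m))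
    (x : EuclideanSpace ℝ (Fin d)) : ℝ :=
  ∫ y in Ω, kernel d η (σ x * h) ‖x - y‖ * (logInteraction h T x y * ρ y)

lemma log_one_add_nonneg {a : ℝ} (ha : 0 ≤ a) : 0 ≤ Real.log (1 + a) :=
  Real.log_nonneg (by linarith)

lemma log_one_add_le {a : ℝ} (ha : 0 ≤ a) : Real.log (1 + a) ≤ a := by
  linarith [Real.log_le_sub_one_of_pos (by linarith : 0 < 1 + a)]

lemma abs_log_one_add_sub_le {a b : ℝ} (ha : 0 ≤ a) (hb : 0 ≤ b) :
    |Real.log (1 + a) - Real.log (1 + b)| ≤ |a - b| := by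
  have key : ∀ a b : ℝ, 0 ≤ a → 0 ≤ b → Real.log (1 + a) - Real.log (1 + b) ≤ |a - b| := by
    intro a b ha hb
    rw [← Real.log_div (by linarith) (by linarith)]
    refine (Real.log_le_sub_one_of_pos (by positivity)).trans ?_
    rw [div_sub_one (by linarith), add_sub_add_left_eq_sub]
    refine (div_le_div_of_nonneg_right (le_abs_self _) (by linarith)).trans ?_
    exact div_le_self (abs_nonneg _) (by linarith)
  refine abs_le.2 ⟨?_, key a b ha hb⟩
  have := key b a hb ha
  rw [abs_sub_comm] at this
  linarith

lemma logInteraction_nonneg (h : ℝ) (T : EuclideanSpace ℝ (Fin d) → EuclideanSpace ℝ (Fin m))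
    (x y : EuclideanSpace ℝ (Fin d)) : 0 ≤ logInteraction h T x y :=
  log_one_add_nonneg (by positivity)

lemma logInteraction_le (hT : LipschitzOnWith L T Ω) {y : EuclideanSpace ℝ (Fin d)}
    (hx : x ∈ Ω) (hy : y ∈ Ω) : logInteraction h T x y ≤ L ^ 2 * (‖x - y‖ / h) ^ 2 := by
  refine (log_one_add_le (by positivity)).trans ?_
  have h1 : ‖T x - T y‖ ≤ L * ‖x - y‖ := by
    simpa [dist_eq_norm] using hT.dist_le_mul x hx y hy
  calc (h ^ 2)⁻¹ * ‖T x - T y‖ ^ 2 ≤ (h ^ 2)⁻¹ * (L * ‖x - y‖) ^ 2 := by gcongr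
    _ = _ := by rw [div_pow]; ring

lemma logInteraction_add_smul_le (hσ : IsBandwidth Ω σ σmin σmax) (hT : LipschitzOnWith L T Ω)
    (hh : 0 < h) (hx : x ∈ Ω) {z : EuclideanSpace ℝ (Fin d)} (hz : x + (σ x * h) • z ∈ Ω) :
    logInteraction h T x (x + (σ x * h) • z) ≤ L ^ 2 * (σmax * ‖z‖) ^ 2 := by
  refine (logInteraction_le hT hx hz).trans ?_
  have hσ0 : 0 < σ x := hσ.min_pos.trans_le (hσ.lower x hx)
  rw [sub_add_cancel_left, norm_neg, norm_smul, Real.norm_eq_abs, abs_of_pos (by positivity),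
    mul_right_comm, mul_div_cancel_right₀ _ hh.ne']
  have := hσ.upper x hx
  gcongr

lemma norm_fderiv_le (hΩ : IsOpen Ω) (hd : DifferentiableOn ℝ T Ω) (hT : LipschitzOnWith L T Ω)
    (hx : x ∈ Ω) : ‖fderiv ℝ T x‖ ≤ L :=
  ((hd x hx).differentiableAt (hΩ.mem_nhds hx)).hasFDerivAt.le_of_lipschitzOn (hΩ.mem_nhds hx) hT

lemma norm_smul_fderiv_apply_le (hΩ : IsOpen Ω) (hσ : IsBandwidth Ω σ σmin σmax)
    (hd : DifferentiableOn ℝ T Ω) (hT : LipschitzOnWith L T Ω) (hx : x ∈ Ω)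
    (z : EuclideanSpace ℝ (Fin d)) : ‖(σ x • fderiv ℝ T x) z‖ ≤ L * (σmax * ‖z‖) := by
  have hσ0 : 0 < σ x := hσ.min_pos.trans_le (hσ.lower x hx)
  rw [_root_.smul_apply, norm_smul, Real.norm_eq_abs, abs_of_pos hσ0]
  have h1 := (fderiv ℝ T x).le_of_opNorm_le (norm_fderiv_le hΩ hd hT hx) z
  calc σ x * ‖fderiv ℝ T x z‖ ≤ σmax * (L * ‖z‖) :=
        mul_le_mul (hσ.upper x hx) h1 (norm_nonneg _) (hσ0.le.trans (hσ.upper x hx))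
    _ = _ := by ring

/-- First-order Taylor expansion within the largest ball about `x` contained in `Ω`. -/
lemma norm_sub_sub_fderiv_le (hΩ : IsOpen Ω) (hd : DifferentiableOn ℝ T Ω)
    (hDT : LipschitzOnWith L' (fderiv ℝ T) Ω) (hx : x ∈ Ω) {y : EuclideanSpace ℝ (Fin d)}
    (hy : ‖y - x‖ < Metric.infDist x Ωᶜ) :
    ‖T y - T x - fderiv ℝ T x (y - x)‖ ≤ L' * ‖y - x‖ ^ 2 := by
  have hsub : Metric.closedBall x ‖y - x‖ ⊆ Ω := by
    intro z hz
    by_contra hzΩ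
    have h1 := Metric.infDist_le_dist_of_mem (x := x) (show z ∈ Ωᶜ from hzΩ)
    have h2 := Metric.mem_closedBall.1 hz
    rw [dist_comm] at h2
    linarith
  have := (convex_closedBall x ‖y - x‖).norm_image_sub_le_of_norm_hasFDerivWithin_le'
    (f := T) (f' := fderiv ℝ T) (φ := fderiv ℝ T x) (C := L' * ‖y - x‖) (x := x) (y := y)
    (fun z hz => ((hd z (hsub hz)).differentiableAt
      (hΩ.mem_nhds (hsub hz))).hasFDerivAt.hasFDerivWithinAt)
    (fun z hz => by
      have h1 := hDT.dist_le_mul z (hsub hz) x hx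
      rw [dist_eq_norm] at h1
      exact h1.trans (mul_le_mul_of_nonneg_left (Metric.mem_closedBall.1 hz) L'.2))
    (Metric.mem_closedBall_self (norm_nonneg _)) (by simp [dist_eq_norm])
  linarith

/-- The points of the rescaled picture which may fall outside `Ω` are absorbed by the layer weight,
at the price of two powers of `|z|`. -/
lemma one_le_layerWeight_mul (hΩ : IsOpen Ω) (hne : Ωᶜ.Nonempty) (hσmax : 0 ≤ σmax)
    (hx : x ∈ Ω) {z : EuclideanSpace ℝ (Fin d)}
    (hz : Metric.infDist x Ωᶜ ≤ σmax * h * ‖z‖) :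
    1 ≤ layerWeight Ω h x * ((1 + σmax) ^ 2 * (1 + ‖z‖) ^ 2) := by
  have hδ : 0 < Metric.infDist x Ωᶜ :=
    (hΩ.isClosed_compl.notMem_iff_infDist_pos hne).1 fun hc => hc hx
  have hz0 := norm_nonneg z
  have h1 : 1 ≤ 1 + σmax := by linarith
  have h2 : 1 ≤ 1 + ‖z‖ := by linarith
  have h3 : 1 ≤ (1 + σmax) * (1 + ‖z‖) := one_le_mul_of_one_le_of_one_le h1 h2
  rw [← mul_pow]
  rcases min_choice 1 ((h / Metric.infDist x Ωᶜ) ^ 2) with hw | hw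
  · rw [layerWeight, hw, one_mul]; exact one_le_pow₀ h3
  · rw [layerWeight, hw, ← mul_pow]
    refine one_le_pow₀ ?_
    have h4 : 1 ≤ h / Metric.infDist x Ωᶜ * (σmax * ‖z‖) := by
      rw [div_mul_eq_mul_div, one_le_div hδ]; linarith
    have h5 : 0 ≤ h / Metric.infDist x Ωᶜ := by
      by_contra! hneg
      have : h / Metric.infDist x Ωᶜ * (σmax * ‖z‖) ≤ 0 :=
        mul_nonpos_of_nonpos_of_nonneg hneg.le (by positivity)
      linarith
    refine h4.trans (mul_le_mul_of_nonneg_left ?_ h5)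
    nlinarith [mul_nonneg hσmax hz0]

lemma mem_of_mul_norm_lt {s : ℝ} (hs : 0 < s) {z : EuclideanSpace ℝ (Fin d)}
    (hz : s * ‖z‖ < Metric.infDist x Ωᶜ) : x + s • z ∈ Ω := by
  by_contra hzΩ
  have h1 := Metric.infDist_le_dist_of_mem (x := x) (show x + s • z ∈ Ωᶜ from hzΩ)
  rw [dist_eq_norm, sub_add_cancel_left, norm_neg, norm_smul, Real.norm_eq_abs,
    abs_of_pos hs] at h1
  linarith

lemma measurable_indicator_of_continuousOn {F : Type*} [TopologicalSpace F] [MeasurableSpace F]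
    [BorelSpace F] [Zero F] (hΩ : IsOpen Ω) {f : EuclideanSpace ℝ (Fin d) → F}
    (hf : ContinuousOn f Ω) : Measurable (Ω.indicator f) := by
  classical
  rw [← Set.piecewise_eq_indicator]
  exact hf.measurable_piecewise continuousOn_const hΩ.measurableSet

lemma IsDataDensity.continuousOn (hρ : IsDataDensity Ω ρ ρmin ρmax) : ContinuousOn ρ Ω :=
  hρ.lipschitz.lipschitzOnWith_lip.continuousOn

lemma IsDataDensity.max_nonneg (hρ : IsDataDensity Ω ρ ρmin ρmax) (hx : x ∈ Ω) : 0 ≤ ρmax :=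
  hρ.min_pos.le.trans ((hρ.lower x hx).trans (hρ.upper x hx))

lemma continuousOn_logInteraction (hT : LipschitzOnWith L T Ω) :
    ContinuousOn (fun y => logInteraction h T x y) Ω := by
  refine ContinuousOn.log ?_ fun y _ => ne_of_gt (by positivity)
  have := hT.continuousOn
  fun_prop

lemma abs_density_sub_le (hΩ : IsOpen Ω) (hne : Ωᶜ.Nonempty) (hρ : IsDataDensity Ω ρ ρmin ρmax)
    (hσ : IsBandwidth Ω σ σmin σmax) (hh : 0 < h) (hx : x ∈ Ω) (z : EuclideanSpace ℝ (Fin d)) :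
    |Ω.indicator ρ (x + (σ x * h) • z) - ρ x| ≤
      (lip ρ Ω * σmax + ρmax * (1 + σmax) ^ 2) * (h + layerWeight Ω h x) * (1 + ‖z‖) ^ 4 := by
  have hσ0 : 0 < σ x := hσ.min_pos.trans_le (hσ.lower x hx)
  have hσmax : 0 < σmax := hσ0.trans_le (hσ.upper x hx)
  have hρmax := hρ.max_nonneg hx
  have hw := layerWeight_nonneg (Ω := Ω) h x
  have hz0 := norm_nonneg z
  have hLρ : (0 : ℝ) ≤ lip ρ Ω := NNReal.coe_nonneg _
  have hs : 0 < σ x * h := by positivity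
  have hz1 : 1 ≤ 1 + ‖z‖ := by linarith
  by_cases hz : x + (σ x * h) • z ∈ Ω
  · rw [Set.indicator_of_mem hz]
    have h1 := hρ.lipschitz.lipschitzOnWith_lip.dist_le_mul _ hz x hx
    rw [Real.dist_eq, dist_eq_norm, add_sub_cancel_left, norm_smul, Real.norm_eq_abs,
      abs_of_pos hs] at h1
    have h2 : ‖z‖ ≤ (1 + ‖z‖) ^ 4 :=
      (by linarith : ‖z‖ ≤ 1 + ‖z‖).trans (le_self_pow₀ hz1 (by norm_num))
    calc _ ≤ (lip ρ Ω : ℝ) * (σmax * h * ‖z‖) := by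
          refine h1.trans ?_
          have := hσ.upper x hx
          gcongr
      _ ≤ (lip ρ Ω : ℝ) * (σmax * h * (1 + ‖z‖) ^ 4) := by gcongr
      _ = lip ρ Ω * σmax * h * (1 + ‖z‖) ^ 4 := by ring
      _ ≤ _ := by
          gcongr
          · exact le_add_of_nonneg_right (by positivity)
          · linarith
  · rw [Set.indicator_of_notMem hz, zero_sub, abs_neg,
      abs_of_nonneg (hρ.min_pos.le.trans (hρ.lower x hx))]
    have hfar : Metric.infDist x Ωᶜ ≤ σmax * h * ‖z‖ := by
      have := not_lt.1 (mt (mem_of_mul_norm_lt hs) hz)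
      refine this.trans ?_
      have := hσ.upper x hx
      gcongr
    have h1 := one_le_layerWeight_mul hΩ hne hσmax.le hx hfar
    have h2 : (1 + ‖z‖) ^ 2 ≤ (1 + ‖z‖) ^ 4 := pow_le_pow_right₀ hz1 (by norm_num)
    calc ρ x ≤ ρmax * 1 := by rw [mul_one]; exact hρ.upper x hx
      _ ≤ ρmax * (layerWeight Ω h x * ((1 + σmax) ^ 2 * (1 + ‖z‖) ^ 2)) := by gcongr
      _ ≤ ρmax * (layerWeight Ω h x * ((1 + σmax) ^ 2 * (1 + ‖z‖) ^ 4)) := by gcongr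
      _ = ρmax * (1 + σmax) ^ 2 * layerWeight Ω h x * (1 + ‖z‖) ^ 4 := by ring
      _ ≤ _ := by
          gcongr
          · exact le_add_of_nonneg_left (by positivity)
          · linarith

lemma abs_meanDegree_sub_le (hη : IsGraphKernel d η) (hΩ : IsOpen Ω) (hne : Ωᶜ.Nonempty)
    (hρ : IsDataDensity Ω ρ ρmin ρmax) (hσ : IsBandwidth Ω σ σmin σmax) (hh : 0 < h)
    (hx : x ∈ Ω) :
    |meanDegree Ω ρ η σ h x - ρ x| ≤ (lip ρ Ω * σmax + ρmax * (1 + σmax) ^ 2) *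
      (h + layerWeight Ω h x) * polyMoment d η := by
  have hσ0 : 0 < σ x := hσ.min_pos.trans_le (hσ.lower x hx)
  have h1 := hη.abs_setIntegral_kernel_sub_le hΩ.measurableSet (by positivity : 0 < σ x * h) x
    (measurable_indicator_of_continuousOn hΩ hρ.continuousOn) (e := fun _ => ρ x)
    measurable_const (B := |ρ x|) (abs_density_sub_le hΩ hne hρ hσ hh hx) (fun z =>
      le_mul_of_one_le_right (abs_nonneg _) (one_le_pow₀ (by linarith [norm_nonneg z])))
  rwa [integral_mul_const, hη.mass_one, one_mul] at h1

/-- The logarithmic interaction against its linearization, at points `y = x + σ(x) h z` of a ball about `x` inside `Ω`. -/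
lemma abs_logInteraction_sub_le (hΩ : IsOpen Ω) (hσ : IsBandwidth Ω σ σmin σmax)
    (hd : DifferentiableOn ℝ T Ω) (hT : LipschitzOnWith L T Ω)
    (hDT : LipschitzOnWith L' (fderiv ℝ T) Ω) (hh : 0 < h) (hx : x ∈ Ω)
    {z : EuclideanSpace ℝ (Fin d)} (hz : σ x * h * ‖z‖ < Metric.infDist x Ωᶜ) :
    |logInteraction h T x (x + (σ x * h) • z) -
        Real.log (1 + ‖(σ x • fderiv ℝ T x) z‖ ^ 2)| ≤
      ((L : ℝ) ^ 2 + (L' : ℝ) ^ 2) * σmax ^ 3 * h * ‖z‖ ^ 3 := by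
  have hσ0 : 0 < σ x := hσ.min_pos.trans_le (hσ.lower x hx)
  have hσle := hσ.upper x hx
  have hσmax : 0 < σmax := hσ0.trans_le hσle
  have hs : 0 < σ x * h := by positivity
  have hyΩ := mem_of_mul_norm_lt hs hz
  set y := x + (σ x * h) • z with hy
  have hyx : y - x = (σ x * h) • z := by rw [hy, add_sub_cancel_left]
  have hyn : ‖y - x‖ = σ x * h * ‖z‖ := by
    rw [hyx, norm_smul, Real.norm_eq_abs, abs_of_pos hs]
  set u := h⁻¹ • (T y - T x) with hu
  set v := (σ x • fderiv ℝ T x) z with hv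
  have hlg : logInteraction h T x y = Real.log (1 + ‖u‖ ^ 2) := by
    rw [logInteraction, hu, norm_smul, Real.norm_eq_abs, mul_pow, sq_abs, inv_pow,
      norm_sub_rev]
  have hun : ‖u‖ ≤ L * (σmax * ‖z‖) := by
    have h1 := hT.dist_le_mul y hyΩ x hx
    rw [dist_eq_norm, dist_eq_norm, hyn] at h1
    rw [hu, norm_smul, Real.norm_eq_abs, abs_of_pos (by positivity : 0 < h⁻¹),
      inv_mul_le_iff₀ hh]
    calc _ ≤ _ := h1
      _ ≤ L * (σmax * h * ‖z‖) := by gcongr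
      _ = _ := by ring
  have hvn : ‖v‖ ≤ L * (σmax * ‖z‖) := norm_smul_fderiv_apply_le hΩ hσ hd hT hx z
  have huv : ‖u - v‖ ≤ L' * (σmax ^ 2 * h * ‖z‖ ^ 2) := by
    have h1 := norm_sub_sub_fderiv_le hΩ hd hDT hx (hyn ▸ hz)
    have h2 : u - v = h⁻¹ • (T y - T x - fderiv ℝ T x (y - x)) := by
      rw [hyx, map_smul, smul_sub h⁻¹ (T y - T x), smul_smul, hu, hv,
        _root_.smul_apply]
      congr 2
      field_simp
    rw [h2, norm_smul, Real.norm_eq_abs, abs_of_pos (by positivity : 0 < h⁻¹),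
      inv_mul_le_iff₀ hh]
    calc _ ≤ _ := h1
      _ ≤ L' * (σmax * h * ‖z‖) ^ 2 := by rw [hyn]; gcongr
      _ = _ := by ring
  rw [hlg]
  refine (abs_log_one_add_sub_le (sq_nonneg _) (sq_nonneg _)).trans ?_
  have h3 : |‖u‖ ^ 2 - ‖v‖ ^ 2| = |‖u‖ - ‖v‖| * (‖u‖ + ‖v‖) := by
    rw [sq_sub_sq, abs_mul, abs_of_nonneg (by positivity : 0 ≤ ‖u‖ + ‖v‖), mul_comm]
  rw [h3]
  have hLL : 2 * ((L' : ℝ) * L) ≤ (L : ℝ) ^ 2 + (L' : ℝ) ^ 2 := by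
    nlinarith [sq_nonneg ((L : ℝ) - L')]
  calc |‖u‖ - ‖v‖| * (‖u‖ + ‖v‖) ≤
        (L' * (σmax ^ 2 * h * ‖z‖ ^ 2)) * (L * (σmax * ‖z‖) + L * (σmax * ‖z‖)) := by
        gcongr
        exact (abs_norm_sub_norm_le u v).trans huv
    _ = 2 * (L' * L) * (σmax ^ 3 * h * ‖z‖ ^ 3) := by ring
    _ ≤ ((L : ℝ) ^ 2 + (L' : ℝ) ^ 2) * (σmax ^ 3 * h * ‖z‖ ^ 3) := by gcongr
    _ = _ := by ring

lemma log_linearized_le (hΩ : IsOpen Ω) (hσ : IsBandwidth Ω σ σmin σmax)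
    (hd : DifferentiableOn ℝ T Ω) (hT : LipschitzOnWith L T Ω) (hx : x ∈ Ω)
    (z : EuclideanSpace ℝ (Fin d)) :
    Real.log (1 + ‖(σ x • fderiv ℝ T x) z‖ ^ 2) ≤ L ^ 2 * (σmax * ‖z‖) ^ 2 := by
  refine (log_one_add_le (sq_nonneg _)).trans ?_
  rw [← mul_pow]
  have := norm_smul_fderiv_apply_le hΩ hσ hd hT hx z
  gcongr

/-- Pointwise comparison of the nonlocal and the linearized integrand. Within the largest ball
inside `Ω` this is Taylor's formula; elsewhere each side is `O(|z|²)` on its own. -/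
lemma abs_integrand_sub_le (hΩ : IsOpen Ω) (hne : Ωᶜ.Nonempty)
    (hρ : IsDataDensity Ω ρ ρmin ρmax) (hσ : IsBandwidth Ω σ σmin σmax)
    (hd : DifferentiableOn ℝ T Ω) (hT : LipschitzOnWith L T Ω)
    (hDT : LipschitzOnWith L' (fderiv ℝ T) Ω) (hh : 0 < h) (hx : x ∈ Ω)
    (z : EuclideanSpace ℝ (Fin d)) :
    |Ω.indicator (fun y => logInteraction h T x y * ρ y) (x + (σ x * h) • z) -
        Real.log (1 + ‖(σ x • fderiv ℝ T x) z‖ ^ 2) * ρ x| ≤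
      ((L : ℝ) ^ 2 + (L' : ℝ) ^ 2) * (σmax ^ 3 * (lip ρ Ω + ρmax) +
        ρmax * σmax ^ 2 * (1 + σmax) ^ 2) * (h + layerWeight Ω h x) * (1 + ‖z‖) ^ 4 := by
  have hσ0 : 0 < σ x := hσ.min_pos.trans_le (hσ.lower x hx)
  have hσle := hσ.upper x hx
  have hσmax : 0 < σmax := hσ0.trans_le hσle
  have hρmax := hρ.max_nonneg hx
  have hw := layerWeight_nonneg (Ω := Ω) h x
  have hz0 := norm_nonneg z
  have hLρ : (0 : ℝ) ≤ lip ρ Ω := NNReal.coe_nonneg _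
  have hs : 0 < σ x * h := by positivity
  have hz1 : 1 ≤ 1 + ‖z‖ := by linarith
  have hlin := log_linearized_le hΩ hσ hd hT hx z
  have hlin0 : 0 ≤ Real.log (1 + ‖(σ x • fderiv ℝ T x) z‖ ^ 2) :=
    log_one_add_nonneg (sq_nonneg _)
  have hρx0 : 0 ≤ ρ x := hρ.min_pos.le.trans (hρ.lower x hx)
  have hQ : (L : ℝ) ^ 2 ≤ (L : ℝ) ^ 2 + (L' : ℝ) ^ 2 := by linarith [sq_nonneg (L' : ℝ)]
  rcases lt_or_ge (σ x * h * ‖z‖) (Metric.infDist x Ωᶜ) with hnear | hfar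
  · have hyΩ := mem_of_mul_norm_lt hs hnear
    rw [Set.indicator_of_mem hyΩ]
    have h1 := abs_logInteraction_sub_le hΩ hσ hd hT hDT hh hx hnear
    have h2 := logInteraction_add_smul_le hσ hT hh hx hyΩ
    have h20 := logInteraction_nonneg h T x (x + (σ x * h) • z)
    have h3 := hρ.lipschitz.lipschitzOnWith_lip.dist_le_mul _ hyΩ x hx
    rw [Real.dist_eq, dist_eq_norm, add_sub_cancel_left, norm_smul, Real.norm_eq_abs,
      abs_of_pos hs] at h3
    have h4 : ‖z‖ ^ 3 ≤ (1 + ‖z‖) ^ 4 :=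
      (pow_le_pow_left₀ hz0 (by linarith) 3).trans (pow_le_pow_right₀ hz1 (by norm_num))
    set lg := logInteraction h T x (x + (σ x * h) • z)
    set ll := Real.log (1 + ‖(σ x • fderiv ℝ T x) z‖ ^ 2)
    have h5 : lg * ρ (x + (σ x * h) • z) - ll * ρ x =
        lg * (ρ (x + (σ x * h) • z) - ρ x) + (lg - ll) * ρ x := by ring
    rw [h5]
    calc _ ≤ |lg * (ρ (x + (σ x * h) • z) - ρ x)| + |(lg - ll) * ρ x| := abs_add_le _ _
      _ = lg * |ρ (x + (σ x * h) • z) - ρ x| + |lg - ll| * ρ x := by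
          rw [abs_mul, abs_mul, abs_of_nonneg h20, abs_of_nonneg hρx0]
      _ ≤ (L ^ 2 * (σmax * ‖z‖) ^ 2) * (lip ρ Ω * (σmax * h * ‖z‖)) +
          (((L : ℝ) ^ 2 + (L' : ℝ) ^ 2) * σmax ^ 3 * h * ‖z‖ ^ 3) * ρmax := by
          gcongr
          · exact h3.trans (by gcongr)
          · exact hρ.upper x hx
      _ ≤ (((L : ℝ) ^ 2 + (L' : ℝ) ^ 2) * (σmax * ‖z‖) ^ 2) * (lip ρ Ω * (σmax * h * ‖z‖)) +
          (((L : ℝ) ^ 2 + (L' : ℝ) ^ 2) * σmax ^ 3 * h * ‖z‖ ^ 3) * ρmax := by gcongr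
      _ = ((L : ℝ) ^ 2 + (L' : ℝ) ^ 2) * (σmax ^ 3 * (lip ρ Ω + ρmax)) * h * ‖z‖ ^ 3 := by ring
      _ ≤ _ := by
          gcongr
          · exact le_add_of_nonneg_right (by positivity)
          · linarith
  · have h1 := one_le_layerWeight_mul hΩ hne hσmax.le hx
      (hfar.trans (by gcongr : _ ≤ σmax * h * ‖z‖))
    have h2 : (‖z‖ ^ 2) * (1 + ‖z‖) ^ 2 ≤ (1 + ‖z‖) ^ 4 := by
      calc (‖z‖ ^ 2) * (1 + ‖z‖) ^ 2 ≤ (1 + ‖z‖) ^ 2 * (1 + ‖z‖) ^ 2 := by gcongr; linarith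
        _ = _ := by ring
    have h3 : |Ω.indicator (fun y => logInteraction h T x y * ρ y) (x + (σ x * h) • z) -
        Real.log (1 + ‖(σ x • fderiv ℝ T x) z‖ ^ 2) * ρ x| ≤ L ^ 2 * (σmax * ‖z‖) ^ 2 * ρmax := by
      have hb : Real.log (1 + ‖(σ x • fderiv ℝ T x) z‖ ^ 2) * ρ x ≤
          L ^ 2 * (σmax * ‖z‖) ^ 2 * ρmax :=
        mul_le_mul hlin (hρ.upper x hx) hρx0 (by positivity)
      have hb0 := mul_nonneg hlin0 hρx0
      by_cases hyΩ : x + (σ x * h) • z ∈ Ω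
      · rw [Set.indicator_of_mem hyΩ]
        have ha : logInteraction h T x (x + (σ x * h) • z) * ρ (x + (σ x * h) • z) ≤
            L ^ 2 * (σmax * ‖z‖) ^ 2 * ρmax :=
          mul_le_mul (logInteraction_add_smul_le hσ hT hh hx hyΩ) (hρ.upper _ hyΩ)
            (hρ.min_pos.le.trans (hρ.lower _ hyΩ)) (by positivity)
        have ha0 := mul_nonneg (logInteraction_nonneg h T x (x + (σ x * h) • z))
          (hρ.min_pos.le.trans (hρ.lower _ hyΩ))
        exact abs_le.2 ⟨by linarith, by linarith⟩
      · rw [Set.indicator_of_notMem hyΩ, zero_sub, abs_neg, abs_of_nonneg hb0]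
        exact hb
    calc _ ≤ _ := h3
      _ ≤ ((L : ℝ) ^ 2 + (L' : ℝ) ^ 2) * (σmax * ‖z‖) ^ 2 * ρmax * 1 := by rw [mul_one]; gcongr
      _ ≤ ((L : ℝ) ^ 2 + (L' : ℝ) ^ 2) * (σmax * ‖z‖) ^ 2 * ρmax *
          (layerWeight Ω h x * ((1 + σmax) ^ 2 * (1 + ‖z‖) ^ 2)) := by gcongr
      _ = ((L : ℝ) ^ 2 + (L' : ℝ) ^ 2) * (ρmax * σmax ^ 2 * (1 + σmax) ^ 2) *
          layerWeight Ω h x * (‖z‖ ^ 2 * (1 + ‖z‖) ^ 2) := by ring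
      _ ≤ ((L : ℝ) ^ 2 + (L' : ℝ) ^ 2) * (ρmax * σmax ^ 2 * (1 + σmax) ^ 2) *
          layerWeight Ω h x * (1 + ‖z‖) ^ 4 := by gcongr
      _ ≤ _ := by
          gcongr
          · exact le_add_of_nonneg_left (by positivity)
          · linarith

lemma sq_mul_norm_le_poly (L : ℝ≥0) (σmax : ℝ) (z : EuclideanSpace ℝ (Fin d)) :
    (L : ℝ) ^ 2 * (σmax * ‖z‖) ^ 2 ≤ L ^ 2 * σmax ^ 2 * (1 + ‖z‖) ^ 4 := by
  have hz0 := norm_nonneg z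
  have : ‖z‖ ^ 2 ≤ (1 + ‖z‖) ^ 4 :=
    (pow_le_pow_left₀ hz0 (by linarith) 2).trans (pow_le_pow_right₀ (by linarith) (by norm_num))
  calc (L : ℝ) ^ 2 * (σmax * ‖z‖) ^ 2 = L ^ 2 * σmax ^ 2 * ‖z‖ ^ 2 := by ring
    _ ≤ _ := by gcongr

lemma abs_meanAttraction_sub_le (hη : IsGraphKernel d η) (hΩ : IsOpen Ω) (hne : Ωᶜ.Nonempty)
    (hρ : IsDataDensity Ω ρ ρmin ρmax) (hσ : IsBandwidth Ω σ σmin σmax)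
    (hd : DifferentiableOn ℝ T Ω) (hT : LipschitzOnWith L T Ω)
    (hDT : LipschitzOnWith L' (fderiv ℝ T) Ω) (hh : 0 < h) (hx : x ∈ Ω) :
    |meanAttraction Ω ρ η σ h T x - Phi η 1 (σ x • fderiv ℝ T x) * ρ x| ≤
      ((L : ℝ) ^ 2 + (L' : ℝ) ^ 2) * (σmax ^ 3 * (lip ρ Ω + ρmax) +
        ρmax * σmax ^ 2 * (1 + σmax) ^ 2) * (h + layerWeight Ω h x) * polyMoment d η := by
  have hσ0 : 0 < σ x := hσ.min_pos.trans_le (hσ.lower x hx)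
  have hm : Measurable fun z => Real.log (1 + ‖(σ x • fderiv ℝ T x) z‖ ^ 2) * ρ x := by
    fun_prop
  have h1 := hη.abs_setIntegral_kernel_sub_le hΩ.measurableSet (by positivity : 0 < σ x * h) x
    (measurable_indicator_of_continuousOn hΩ
      ((continuousOn_logInteraction (h := h) (x := x) hT).mul hρ.continuousOn)) hm
    (B := L ^ 2 * σmax ^ 2 * |ρ x|)
    (abs_integrand_sub_le hΩ hne hρ hσ hd hT hDT hh hx) (fun z => by
      rw [abs_mul, abs_of_nonneg (log_one_add_nonneg (sq_nonneg _)), mul_right_comm]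
      refine mul_le_mul_of_nonneg_right ?_ (abs_nonneg _)
      exact (log_linearized_le hΩ hσ hd hT hx z).trans (sq_mul_norm_le_poly L σmax z))
  have h2 : Phi η 1 (σ x • fderiv ℝ T x) * ρ x = ∫ z : EuclideanSpace ℝ (Fin d),
      η ‖z‖ * (Real.log (1 + ‖(σ x • fderiv ℝ T x) z‖ ^ 2) * ρ x) := by
    rw [Phi, ← integral_mul_const]
    simp only [one_pow, inv_one, mul_assoc]
  rwa [← h2] at h1

lemma Phi_one_nonneg (hη : IsGraphKernel d η)
    (A : EuclideanSpace ℝ (Fin d) →L[ℝ] EuclideanSpace ℝ (Fin m)) : 0 ≤ Phi η 1 A := by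
  refine integral_nonneg fun z => mul_nonneg (hη.eta_nonneg z) ?_
  rw [one_pow, inv_one]
  exact log_one_add_nonneg (sq_nonneg _)

lemma Phi_smul_fderiv_le (hη : IsGraphKernel d η) (hΩ : IsOpen Ω)
    (hσ : IsBandwidth Ω σ σmin σmax) (hd : DifferentiableOn ℝ T Ω) (hT : LipschitzOnWith L T Ω)
    (hx : x ∈ Ω) : Phi η 1 (σ x • fderiv ℝ T x) ≤ L ^ 2 * σmax ^ 2 * polyMoment d η := by
  refine (le_abs_self _).trans (hη.abs_integral_le fun z => ?_)
  rw [one_pow, inv_one, abs_of_nonneg (log_one_add_nonneg (sq_nonneg _))]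
  exact (log_linearized_le hΩ hσ hd hT hx z).trans (sq_mul_norm_le_poly L σmax z)

lemma meanDegree_le (hη : IsGraphKernel d η) (hΩ : IsOpen Ω)
    (hρ : IsDataDensity Ω ρ ρmin ρmax) (hσ : IsBandwidth Ω σ σmin σmax) (hh : 0 < h)
    (hx : x ∈ Ω) : meanDegree Ω ρ η σ h x ≤ ρmax * polyMoment d η := by
  have hσ0 : 0 < σ x := hσ.min_pos.trans_le (hσ.lower x hx)
  refine (le_abs_self _).trans (hη.abs_setIntegral_kernel_le hΩ.measurableSet
    (by positivity : 0 < σ x * h) x (hρ.max_nonneg hx) fun z hz => ?_)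
  rw [abs_of_nonneg (hρ.min_pos.le.trans (hρ.lower _ hz))]
  exact (hρ.upper _ hz).trans (le_mul_of_one_le_right (hρ.max_nonneg hx)
    (one_le_pow₀ (by linarith [norm_nonneg z])))

lemma meanAttraction_nonneg (hη : IsGraphKernel d η) (hΩ : IsOpen Ω)
    (hρ : IsDataDensity Ω ρ ρmin ρmax) (hσ : IsBandwidth Ω σ σmin σmax) (hh : 0 < h)
    (hx : x ∈ Ω) : 0 ≤ meanAttraction Ω ρ η σ h T x := by
  have hσ0 : 0 < σ x := hσ.min_pos.trans_le (hσ.lower x hx)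
  exact setIntegral_nonneg hΩ.measurableSet fun y hy =>
    mul_nonneg (hη.kernel_nonneg (by positivity) (norm_nonneg _))
      (mul_nonneg (logInteraction_nonneg h T x y) (hρ.min_pos.le.trans (hρ.lower y hy)))

lemma meanAttraction_le (hη : IsGraphKernel d η) (hΩ : IsOpen Ω)
    (hρ : IsDataDensity Ω ρ ρmin ρmax) (hσ : IsBandwidth Ω σ σmin σmax)
    (hT : LipschitzOnWith L T Ω) (hh : 0 < h) (hx : x ∈ Ω) :
    meanAttraction Ω ρ η σ h T x ≤ L ^ 2 * (σmax ^ 2 * ρmax * polyMoment d η) := by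
  have hσ0 : 0 < σ x := hσ.min_pos.trans_le (hσ.lower x hx)
  have hρmax := hρ.max_nonneg hx
  refine ((le_abs_self _).trans (hη.abs_setIntegral_kernel_le hΩ.measurableSet
    (by positivity : 0 < σ x * h) x (β := L ^ 2 * σmax ^ 2 * ρmax) (by positivity)
    fun z hz => ?_)).trans (by linarith)
  have hρy : 0 ≤ ρ (x + (σ x * h) • z) := hρ.min_pos.le.trans (hρ.lower _ hz)
  rw [abs_of_nonneg (mul_nonneg (logInteraction_nonneg h T _ _) hρy), mul_right_comm]
  exact mul_le_mul ((logInteraction_add_smul_le hσ hT hh hx hz).trans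
    (sq_mul_norm_le_poly L σmax z)) (hρ.upper _ hz) hρy (by positivity)

/-- The mean degree is bounded below uniformly up to the boundary, by the interior cone property. -/
lemma exists_le_meanDegree [NeZero d] (hη : IsGraphKernel d η) (hΩ : IsOpen Ω)
    (hb : Bornology.IsBounded Ω) (hlip : HasLipschitzBoundary Ω)
    (hρ : IsDataDensity Ω ρ ρmin ρmax) (hσ : IsBandwidth Ω σ σmin σmax) :
    ∃ c₀ h₀ : ℝ, 0 < c₀ ∧ 0 < h₀ ∧ ∀ h, 0 < h → h ≤ h₀ → ∀ x ∈ Ω,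
      c₀ ≤ meanDegree Ω ρ η σ h x := by
  obtain ⟨κ, s₀, hκ, hs₀, hball⟩ := exists_ball_subset hΩ hb hlip
  obtain ⟨t, ht, hηt⟩ := hη.exists_pos
  set v := (volume : Measure (EuclideanSpace ℝ (Fin d))).real (Metric.ball 0 1) with hv
  have hvpos : 0 < v := ENNReal.toReal_pos (Metric.measure_ball_pos _ _ one_pos).ne'
    measure_ball_lt_top.ne
  have hρm := hρ.min_pos
  refine ⟨η t * ρmin * (κ * t) ^ d * v, s₀ / (t * (1 + |σmax|)), by positivity, by positivity,
    fun h hh hhs x hx => ?_⟩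
  have hσ0 : 0 < σ x := hσ.min_pos.trans_le (hσ.lower x hx)
  set s := σ x * h with hs
  have hspos : 0 < s := by positivity
  have hts : t * s ≤ s₀ := by
    rw [le_div_iff₀ (by positivity)] at hhs
    have : σ x ≤ 1 + |σmax| := (hσ.upper x hx).trans ((le_abs_self _).trans (by linarith))
    calc t * s = h * (t * σ x) := by rw [hs]; ring
      _ ≤ h * (t * (1 + |σmax|)) := by gcongr
      _ ≤ s₀ := hhs
  obtain ⟨y₀, hy₀⟩ := hball x hx (t * s) (by positivity) hts
  have hnn : ∀ y ∈ Ω, 0 ≤ kernel d η s ‖x - y‖ * ρ y := fun y hy =>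
    mul_nonneg (hη.kernel_nonneg hspos (norm_nonneg _)) (hρm.le.trans (hρ.lower y hy))
  have hint : IntegrableOn (fun y => kernel d η s ‖x - y‖ * ρ y) Ω := by
    have : IsFiniteMeasure (volume.restrict Ω) := ⟨by simpa using hb.measure_lt_top⟩
    refine Integrable.of_bound ?_ ((s ^ d)⁻¹ * η 0 * ρmax) ?_
    · exact ((hη.measurable_kernel hspos x).aemeasurable.mul
        (hρ.continuousOn.aemeasurable hΩ.measurableSet)).aestronglyMeasurable
    · refine (ae_restrict_iff' hΩ.measurableSet).2 (Filter.Eventually.of_forall fun y hy => ?_)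
      rw [Real.norm_eq_abs, abs_of_nonneg (hnn y hy)]
      exact mul_le_mul (hη.kernel_le hspos (norm_nonneg _)) (hρ.upper y hy)
        (hρm.le.trans (hρ.lower y hy)) (by have := hη.zero_pos; positivity)
  have hsub : Metric.ball y₀ (κ * (t * s)) ⊆ Ω := hy₀.trans Set.inter_subset_left
  have hlow : ∀ y ∈ Metric.ball y₀ (κ * (t * s)),
      (s ^ d)⁻¹ * η t * ρmin ≤ kernel d η s ‖x - y‖ * ρ y := by
    intro y hy
    have h1 : ‖x - y‖ < t * s := by
      rw [← dist_eq_norm, dist_comm]; exact (hy₀ hy).2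
    have h2 : ‖x - y‖ / s ≤ t := (div_le_iff₀ hspos).2 h1.le
    have h3 : η t ≤ η (‖x - y‖ / s) :=
      hη.antitone (show (0 : ℝ) ≤ ‖x - y‖ / s by positivity) ht.le h2
    exact mul_le_mul (mul_le_mul_of_nonneg_left h3 (by positivity)) (hρ.lower y (hsub hy))
      hρm.le (hη.kernel_nonneg hspos (norm_nonneg _))
  have hvol : (volume : Measure (EuclideanSpace ℝ (Fin d))).real
      (Metric.ball y₀ (κ * (t * s))) = (κ * (t * s)) ^ d * v := by
    rw [measureReal_def, Measure.addHaar_ball volume y₀ (by positivity), ENNReal.toReal_mul,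
      finrank_euclideanSpace_fin, ENNReal.toReal_ofReal (by positivity), hv, measureReal_def]
  calc η t * ρmin * (κ * t) ^ d * v
      = (s ^ d)⁻¹ * η t * ρmin * ((κ * (t * s)) ^ d * v) := by
        rw [← mul_assoc κ t s, mul_pow (κ * t) s]; field_simp
    _ ≤ ∫ y in Metric.ball y₀ (κ * (t * s)), kernel d η s ‖x - y‖ * ρ y := by
        rw [← hvol]
        exact setIntegral_ge_of_const_le_real measurableSet_ball measure_ball_lt_top.ne hlow
          (hint.mono_set hsub)
    _ ≤ ∫ y in Ω, kernel d η s ‖x - y‖ * ρ y :=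
        setIntegral_mono_set hint ((ae_restrict_iff' hΩ.measurableSet).2
          (Filter.Eventually.of_forall hnn)) (Filter.Eventually.of_forall hsub)

/-- The nonlocal attraction density agrees with `Φ₁(σ DT)` up to an error `O(h)` in the bulk and
`O(1)` in the boundary layer. -/
lemma exists_abs_div_sub_Phi_le (hη : IsGraphKernel d η) (hΩ : IsOpen Ω) (hne : Ωᶜ.Nonempty)
    (hρ : IsDataDensity Ω ρ ρmin ρmax) (hσ : IsBandwidth Ω σ σmin σmax) {c₀ : ℝ} (hc₀ : 0 < c₀) :
    ∃ C : ℝ, 0 ≤ C ∧ ∀ (T : EuclideanSpace ℝ (Fin d) → EuclideanSpace ℝ (Fin m)) (L L' : ℝ≥0),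
      DifferentiableOn ℝ T Ω → LipschitzOnWith L T Ω → LipschitzOnWith L' (fderiv ℝ T) Ω →
      ∀ h, 0 < h → ∀ x ∈ Ω, c₀ ≤ meanDegree Ω ρ η σ h x →
        |meanAttraction Ω ρ η σ h T x / meanDegree Ω ρ η σ h x -
            Phi η 1 (σ x • fderiv ℝ T x)| ≤
          C * ((L : ℝ) ^ 2 + (L' : ℝ) ^ 2) * (h + layerWeight Ω h x) := by
  set M := polyMoment d η with hM
  have hM0 : 0 ≤ M := hη.polyMoment_nonneg
  set a := (lip ρ Ω : ℝ) * σmax + ρmax * (1 + σmax) ^ 2 with ha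
  set b := σmax ^ 3 * ((lip ρ Ω : ℝ) + ρmax) + ρmax * σmax ^ 2 * (1 + σmax) ^ 2 with hb
  refine ⟨|(b * M + σmax ^ 2 * M * (a * M)) / c₀|, abs_nonneg _,
    fun T L L' hd hT hDT h hh x hx hD => ?_⟩
  have hσ0 : 0 < σ x := hσ.min_pos.trans_le (hσ.lower x hx)
  have hσmax : 0 < σmax := hσ0.trans_le (hσ.upper x hx)
  have hρmax := hρ.max_nonneg hx
  have hLρ : (0 : ℝ) ≤ lip ρ Ω := NNReal.coe_nonneg _
  have hw := layerWeight_nonneg (Ω := Ω) h x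
  have ha0 : 0 ≤ a := by positivity
  have hb0 : 0 ≤ b := by positivity
  have h1 := abs_meanAttraction_sub_le hη hΩ hne hρ hσ hd hT hDT hh hx
  have h2 := abs_meanDegree_sub_le hη hΩ hne hρ hσ hh hx
  have h3 := Phi_smul_fderiv_le hη hΩ hσ hd hT hx
  have h30 := Phi_one_nonneg (m := m) hη (σ x • fderiv ℝ T x)
  set D := meanDegree Ω ρ η σ h x
  set N := meanAttraction Ω ρ η σ h T x
  set Φ := Phi η 1 (σ x • fderiv ℝ T x)
  set w := layerWeight Ω h x
  rw [← hM] at h1 h2 h3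
  have hDpos : 0 < D := hc₀.trans_le hD
  have hQ : (L : ℝ) ^ 2 ≤ (L : ℝ) ^ 2 + (L' : ℝ) ^ 2 := by linarith [sq_nonneg (L' : ℝ)]
  have heq : N / D - Φ = ((N - Φ * ρ x) - Φ * (D - ρ x)) / D := by field_simp; ring
  rw [heq, abs_div, abs_of_pos hDpos,
    abs_of_nonneg (show 0 ≤ (b * M + σmax ^ 2 * M * (a * M)) / c₀ by positivity)]
  have hnum : |(N - Φ * ρ x) - Φ * (D - ρ x)| ≤
      (b * M + σmax ^ 2 * M * (a * M)) * ((L : ℝ) ^ 2 + (L' : ℝ) ^ 2) * (h + w) := by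
    calc _ ≤ |N - Φ * ρ x| + |Φ * (D - ρ x)| := abs_sub _ _
      _ = |N - Φ * ρ x| + Φ * |D - ρ x| := by rw [abs_mul, abs_of_nonneg h30]
      _ ≤ ((L : ℝ) ^ 2 + (L' : ℝ) ^ 2) * b * (h + w) * M +
          (((L : ℝ) ^ 2 + (L' : ℝ) ^ 2) * σmax ^ 2 * M) * (a * (h + w) * M) := by
          gcongr
          exact h3.trans (by gcongr)
      _ = _ := by ring
  calc _ ≤ (b * M + σmax ^ 2 * M * (a * M)) * ((L : ℝ) ^ 2 + (L' : ℝ) ^ 2) * (h + w) / c₀ := by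
        gcongr
    _ = _ := by ring

end Local

/-! ### Simultaneous concentration of the degrees and the attractions -/

section UniformConcentration

variable {α : Type*} [MeasurableSpace α] {μ : Measure α} [IsProbabilityMeasure μ]

lemma integral_sq_le {f : α → ℝ} (hf : Measurable f) {M b : ℝ} (h0 : ∀ x, 0 ≤ f x)
    (hM : ∀ x, f x ≤ M) (hM0 : 0 ≤ M) (hb : ∫ x, f x ∂μ ≤ b) : ∫ x, f x ^ 2 ∂μ ≤ M * b := by
  have habs : ∀ x, |f x| ≤ M := fun x => by rw [abs_of_nonneg (h0 x)]; exact hM x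
  have hi2 : Integrable (fun x => f x ^ 2) μ :=
    integrable_of_abs_le (M := M ^ 2) (hf.pow_const 2) fun x => by
      rw [abs_pow]; exact pow_le_pow_left₀ (abs_nonneg _) (habs x) 2
  calc ∫ x, f x ^ 2 ∂μ ≤ ∫ x, M * f x ∂μ :=
        integral_mono hi2 ((integrable_of_abs_le hf habs).const_mul M) fun x => by
          simp only [sq]; exact mul_le_mul_of_nonneg_right (hM x) (h0 x)
    _ = M * ∫ x, f x ∂μ := integral_const_mul _ _
    _ ≤ M * b := by gcongr

/-- Row sums of a kernel bounded by `C / H` with second moment at most `C / H`, where `H` plays the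
role of `h ^ d`. The Chernoff exponent is `s = lam * H / √(n * H)`. -/
lemma measureReal_rowSum_deviation_le {a : α → α → ℝ} (ha : Measurable (Function.uncurry a))
    {C H lam : ℝ} (ha0 : ∀ x y, 0 ≤ a x y) (haC : ∀ x y, a x y ≤ C / H)
    (hV : ∀ x, ∫ y, a x y ^ 2 ∂μ ≤ C / H) (hC : 0 ≤ C) (hH : 0 < H) {n : ℕ}
    (hq : 1 ≤ n * H) (hlam : 1 ≤ lam) (hlamq : C ^ 2 * lam ^ 2 ≤ n * H) (i : Fin n) :
    (Measure.pi fun _ : Fin n => μ).real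
        {x | n * ((2 * C + 2) * (lam / Real.sqrt (n * H))) <
          |∑ j, a (x i) (x j) - n * ∫ y, a (x i) y ∂μ|} ≤ 2 * Real.exp (-(2 * lam ^ 2)) := by
  set q := (n : ℝ) * H with hqd
  have hq0 : 0 < q := by linarith
  set w := Real.sqrt q with hw
  have hw0 : 0 < w := Real.sqrt_pos.2 hq0
  have hww : w * w = q := Real.mul_self_sqrt hq0.le
  have hw1 : 1 ≤ w := Real.one_le_sqrt.2 hq
  have hn : (n : ℝ) = w * w / H := by rw [hww, hqd]; field_simp
  have hCw : C * lam ≤ w := by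
    refine Real.le_sqrt_of_sq_le ?_
    rw [mul_pow]; exact hlamq
  have h1 := measureReal_abs_rowSum_sub_le ha ha0 haC hV (s := lam * H / w) (by positivity)
    (by rw [div_mul_div_comm, div_le_one (by positivity)]; nlinarith) i
    (n * ((C + 2) * (lam / w)))
  have hexp : (n : ℝ) * ((lam * H / w) ^ 2 * (C / H)) - lam * H / w * (n * ((C + 2) * (lam / w)))
      = -(2 * lam ^ 2) := by
    rw [hn]; field_simp; ring
  rw [hexp] at h1
  refine (measureReal_mono fun x hx => ?_).trans h1
  -- the diagonal term is at most `C / H = n * C / w ^ 2 ≤ n * C * lam / w`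
  have hdiag : C / H ≤ n * (C * (lam / w)) := by
    have : (n : ℝ) * (C * (lam / w)) = C / H * (w * lam) := by rw [hn]; field_simp
    rw [this]
    exact le_mul_of_one_le_right (by positivity) (one_le_mul_of_one_le_of_one_le hw1 hlam)
  rw [Set.mem_ofPred_eq] at hx ⊢
  refine lt_of_le_of_lt ?_ hx
  calc _ ≤ n * ((C + 2) * (lam / w)) + n * (C * (lam / w)) := by gcongr
    _ = _ := by ring

lemma measureReal_sum_deviation_le {f : α → ℝ} (hf : Measurable f) {C H lam : ℝ}
    (hf0 : ∀ x, 0 ≤ f x) (hfC : ∀ x, f x ≤ C) (hV : ∫ x, f x ^ 2 ∂μ ≤ C) (hC : 0 ≤ C)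
    (hH : 0 < H) (hH1 : H ≤ 1) {n : ℕ} (hq : 1 ≤ n * H) (hlam : 1 ≤ lam)
    (hlamq : C ^ 2 * lam ^ 2 ≤ n * H) :
    (Measure.pi fun _ : Fin n => μ).real
        {x | n * ((2 * C + 2) * (lam / Real.sqrt (n * H))) <
          |∑ j, f (x j) - n * ∫ y, f y ∂μ|} ≤ 2 * Real.exp (-(2 * lam ^ 2)) := by
  have hCH : C ≤ C / H := by rw [le_div_iff₀ hH]; nlinarith
  set q := (n : ℝ) * H with hqd
  have hq0 : 0 < q := by linarith
  set w := Real.sqrt q with hw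
  have hw0 : 0 < w := Real.sqrt_pos.2 hq0
  have hww : w * w = q := Real.mul_self_sqrt hq0.le
  have hn : (n : ℝ) = w * w / H := by rw [hww, hqd]; field_simp
  have hCw : C * lam ≤ w := by
    refine Real.le_sqrt_of_sq_le ?_
    rw [mul_pow]; exact hlamq
  have h1 := measureReal_abs_sum_sub_le hf hf0 (fun x => (hfC x).trans hCH) (hV.trans hCH)
    (s := lam * H / w) (by positivity)
    (by rw [div_mul_div_comm, div_le_one (by positivity)]; nlinarith) n
    (n * ((C + 2) * (lam / w)))
  have hexp : (n : ℝ) * ((lam * H / w) ^ 2 * (C / H)) - lam * H / w * (n * ((C + 2) * (lam / w)))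
      = -(2 * lam ^ 2) := by
    rw [hn]; field_simp; ring
  rw [hexp] at h1
  refine (measureReal_mono fun x hx => ?_).trans h1
  rw [Set.mem_ofPred_eq] at hx ⊢
  refine lt_of_le_of_lt ?_ hx
  gcongr
  linarith

/-- Union bound over the `2 n` row sums of two kernels and one sample mean. -/
lemma measureReal_exists_deviation_le {a b : α → α → ℝ} {f : α → ℝ}
    (ha : Measurable (Function.uncurry a)) (hb : Measurable (Function.uncurry b))
    (hf : Measurable f) {C H lam : ℝ}
    (ha0 : ∀ x y, 0 ≤ a x y) (haC : ∀ x y, a x y ≤ C / H) (haV : ∀ x, ∫ y, a x y ^ 2 ∂μ ≤ C / H)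
    (hb0 : ∀ x y, 0 ≤ b x y) (hbC : ∀ x y, b x y ≤ C / H) (hbV : ∀ x, ∫ y, b x y ^ 2 ∂μ ≤ C / H)
    (hf0 : ∀ x, 0 ≤ f x) (hfC : ∀ x, f x ≤ C) (hfV : ∫ x, f x ^ 2 ∂μ ≤ C)
    (hC : 0 ≤ C) (hH : 0 < H) (hH1 : H ≤ 1) {n : ℕ} (hq : 1 ≤ n * H) (hlam : 1 ≤ lam)
    (hlamq : C ^ 2 * lam ^ 2 ≤ n * H) {ε : ℝ}
    (hε : ε = (2 * C + 2) * (lam / Real.sqrt (n * H))) :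
    (Measure.pi fun _ : Fin n => μ).real
        {x | (∃ i, n * ε < |∑ j, a (x i) (x j) - n * ∫ y, a (x i) y ∂μ|) ∨
          (∃ i, n * ε < |∑ j, b (x i) (x j) - n * ∫ y, b (x i) y ∂μ|) ∨
          n * ε < |∑ j, f (x j) - n * ∫ y, f y ∂μ|} ≤
      (4 * n + 2) * Real.exp (-(2 * lam ^ 2)) := by
  subst hε
  have hrow : ∀ {a : α → α → ℝ}, Measurable (Function.uncurry a) → (∀ x y, 0 ≤ a x y) →
      (∀ x y, a x y ≤ C / H) → (∀ x, ∫ y, a x y ^ 2 ∂μ ≤ C / H) →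
      (Measure.pi fun _ : Fin n => μ).real (⋃ i : Fin n,
        {x | n * ((2 * C + 2) * (lam / Real.sqrt (n * H))) <
          |∑ j, a (x i) (x j) - n * ∫ y, a (x i) y ∂μ|}) ≤
        2 * n * Real.exp (-(2 * lam ^ 2)) := by
    intro a ha ha0 haC haV
    refine (measureReal_iUnion_fintype_le _).trans ((Finset.sum_le_sum fun i _ =>
      measureReal_rowSum_deviation_le ha ha0 haC haV hC hH hq hlam hlamq i).trans (le_of_eq ?_))
    simp only [Finset.sum_const, Finset.card_univ, Fintype.card_fin, nsmul_eq_mul]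
    ring
  have h1 := hrow ha ha0 haC haV
  have h2 := hrow hb hb0 hbC hbV
  have h3 := measureReal_sum_deviation_le hf hf0 hfC hfV hC hH hH1 hq hlam hlamq
  set A := ⋃ i : Fin n, {x : Fin n → α | n * ((2 * C + 2) * (lam / Real.sqrt (n * H))) <
          |∑ j, a (x i) (x j) - n * ∫ y, a (x i) y ∂μ|} with hA
  set B := ⋃ i : Fin n, {x : Fin n → α | n * ((2 * C + 2) * (lam / Real.sqrt (n * H))) <
          |∑ j, b (x i) (x j) - n * ∫ y, b (x i) y ∂μ|} with hB
  set F := {x : Fin n → α | n * ((2 * C + 2) * (lam / Real.sqrt (n * H))) <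
          |∑ j, f (x j) - n * ∫ y, f y ∂μ|} with hF
  have hsub : {x : Fin n → α |
          (∃ i, n * ((2 * C + 2) * (lam / Real.sqrt (n * H))) <
            |∑ j, a (x i) (x j) - n * ∫ y, a (x i) y ∂μ|) ∨
          (∃ i, n * ((2 * C + 2) * (lam / Real.sqrt (n * H))) <
            |∑ j, b (x i) (x j) - n * ∫ y, b (x i) y ∂μ|) ∨
          n * ((2 * C + 2) * (lam / Real.sqrt (n * H))) <
            |∑ j, f (x j) - n * ∫ y, f y ∂μ|} ⊆ A ∪ (B ∪ F) := by
    rintro x (⟨i, hi⟩ | ⟨i, hi⟩ | hx)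
    · exact Or.inl (Set.mem_iUnion.2 ⟨i, hi⟩)
    · exact Or.inr (Or.inl (Set.mem_iUnion.2 ⟨i, hi⟩))
    · exact Or.inr (Or.inr hx)
  have h4 := measureReal_mono (μ := Measure.pi fun _ : Fin n => μ) hsub
  have h5 := measureReal_union_le (μ := Measure.pi fun _ : Fin n => μ) A (B ∪ F)
  have h6 := measureReal_union_le (μ := Measure.pi fun _ : Fin n => μ) B F
  linarith

end UniformConcentration

/-! ### The normalized kernels of the t-SNE attraction -/

section Kernels

variable {d m : ℕ} {Ω : Set (EuclideanSpace ℝ (Fin d))} {ρ σ : EuclideanSpace ℝ (Fin d) → ℝ}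
  {η : ℝ → ℝ} {ρmin ρmax σmin σmax : ℝ}
  {T : EuclideanSpace ℝ (Fin d) → EuclideanSpace ℝ (Fin m)} {L L' : ℝ≥0} {h : ℝ}

lemma IsDataDensity.aemeasurable (hρ : IsDataDensity Ω ρ ρmin ρmax) (hΩ : IsOpen Ω) :
    AEMeasurable ρ (volume.restrict Ω) :=
  hρ.continuousOn.aemeasurable hΩ.measurableSet

lemma IsDataDensity.integrableOn (hρ : IsDataDensity Ω ρ ρmin ρmax) : IntegrableOn ρ Ω := by
  by_contra hi
  have := hρ.mass_one
  rw [integral_undef hi] at this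
  exact zero_ne_one this

lemma IsDataDensity.nonneg (hρ : IsDataDensity Ω ρ ρmin ρmax)
    {x : EuclideanSpace ℝ (Fin d)} (hx : x ∈ Ω) : 0 ≤ ρ x :=
  hρ.min_pos.le.trans (hρ.lower x hx)

lemma isProbabilityMeasure_dataLaw (hΩ : IsOpen Ω) (hρ : IsDataDensity Ω ρ ρmin ρmax) :
    IsProbabilityMeasure (dataLaw Ω ρ) := by
  refine ⟨?_⟩
  rw [dataLaw, withDensity_apply _ MeasurableSet.univ, Measure.restrict_univ,
    ← ofReal_integral_eq_lintegral_ofReal hρ.integrableOn, hρ.mass_one, ENNReal.ofReal_one]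
  exact (ae_restrict_iff' hΩ.measurableSet).2 (Filter.Eventually.of_forall fun x hx => hρ.nonneg hx)

lemma ae_mem_dataLaw (hΩ : IsOpen Ω) : ∀ᵐ x ∂(dataLaw Ω ρ), x ∈ Ω :=
  (withDensity_absolutelyContinuous _ _).ae_le (ae_restrict_mem hΩ.measurableSet)

lemma integral_dataLaw (hΩ : IsOpen Ω) (hρ : IsDataDensity Ω ρ ρmin ρmax)
    (f : EuclideanSpace ℝ (Fin d) → ℝ) :
    ∫ x, f x ∂(dataLaw Ω ρ) = ∫ x in Ω, f x * ρ x := by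
  rw [dataLaw, integral_withDensity_eq_integral_toReal_smul₀
    (hρ.aemeasurable hΩ).ennreal_ofReal (Filter.Eventually.of_forall fun _ => ENNReal.ofReal_lt_top)]
  refine setIntegral_congr_fun hΩ.measurableSet fun x hx => ?_
  simp only [smul_eq_mul]
  rw [ENNReal.toReal_ofReal (hρ.nonneg hx), mul_comm]

/-- The degree kernel `η_{σ(x) h}(|x - y|)`, set to zero off `Ω × Ω`, where `σ` is arbitrary. -/
noncomputable def degreeKernel (Ω : Set (EuclideanSpace ℝ (Fin d))) (η : ℝ → ℝ)
    (σ : EuclideanSpace ℝ (Fin d) → ℝ) (h : ℝ) (x y : EuclideanSpace ℝ (Fin d)) : ℝ :=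
  (Ω ×ˢ Ω).indicator (fun p => kernel d η (σ p.1 * h) ‖p.1 - p.2‖) (x, y)

/-- The attraction kernel divided by the squared Lipschitz constant `L` of `T`, set to zero off
`Ω × Ω`. For `L = 0` it vanishes, and so does the logarithmic interaction on `Ω × Ω`. -/
noncomputable def attractionKernel (Ω : Set (EuclideanSpace ℝ (Fin d))) (η : ℝ → ℝ)
    (σ : EuclideanSpace ℝ (Fin d) → ℝ) (h : ℝ)
    (T : EuclideanSpace ℝ (Fin d) → EuclideanSpace ℝ (Fin m)) (L : ℝ≥0)
    (x y : EuclideanSpace ℝ (Fin d)) : ℝ :=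
  (Ω ×ˢ Ω).indicator (fun p => kernel d η (σ p.1 * h) ‖p.1 - p.2‖ *
    (logInteraction h T p.1 p.2 / L ^ 2)) (x, y)

lemma degreeKernel_of_mem {x y : EuclideanSpace ℝ (Fin d)} (hx : x ∈ Ω) (hy : y ∈ Ω) :
    degreeKernel Ω η σ h x y = kernel d η (σ x * h) ‖x - y‖ :=
  Set.indicator_of_mem (Set.mk_mem_prod hx hy) _

lemma degreeKernel_of_notMem {x y : EuclideanSpace ℝ (Fin d)} (hxy : ¬(x ∈ Ω ∧ y ∈ Ω)) :
    degreeKernel Ω η σ h x y = 0 :=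
  Set.indicator_of_notMem (fun hc => hxy (Set.mem_prod.1 hc)) _

lemma attractionKernel_of_notMem {x y : EuclideanSpace ℝ (Fin d)} (hxy : ¬(x ∈ Ω ∧ y ∈ Ω)) :
    attractionKernel Ω η σ h T L x y = 0 :=
  Set.indicator_of_notMem (fun hc => hxy (Set.mem_prod.1 hc)) _

lemma attractionKernel_of_mem {x y : EuclideanSpace ℝ (Fin d)} (hx : x ∈ Ω) (hy : y ∈ Ω) :
    attractionKernel Ω η σ h T L x y =
      kernel d η (σ x * h) ‖x - y‖ * (logInteraction h T x y / L ^ 2) :=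
  Set.indicator_of_mem (Set.mk_mem_prod hx hy) _

lemma sq_mul_logInteraction_div (hT : LipschitzOnWith L T Ω) {x y : EuclideanSpace ℝ (Fin d)}
    (hx : x ∈ Ω) (hy : y ∈ Ω) :
    (L : ℝ) ^ 2 * (logInteraction h T x y / L ^ 2) = logInteraction h T x y := by
  rcases eq_or_ne L 0 with rfl | hL
  · have h1 := logInteraction_le (h := h) hT hx hy
    have h2 := logInteraction_nonneg h T x y
    simp only [NNReal.coe_zero, ne_eq, OfNat.ofNat_ne_zero, not_false_eq_true, zero_pow,
      zero_mul] at h1 ⊢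
    linarith
  · have : (L : ℝ) ≠ 0 := by exact_mod_cast hL
    field_simp

lemma logInteraction_div_le (hT : LipschitzOnWith L T Ω) {x y : EuclideanSpace ℝ (Fin d)}
    (hx : x ∈ Ω) (hy : y ∈ Ω) : logInteraction h T x y / L ^ 2 ≤ (‖x - y‖ / h) ^ 2 :=
  div_le_of_le_mul₀ (by positivity) (by positivity)
    ((logInteraction_le hT hx hy).trans (by rw [mul_comm]))

lemma measurable_degreeKernel (hη : IsGraphKernel d η) (hΩ : IsOpen Ω)
    (hσ : IsBandwidth Ω σ σmin σmax) (hh : 0 < h) :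
    Measurable (Function.uncurry (degreeKernel Ω η σ h)) := by
  have hσm := measurable_indicator_of_continuousOn hΩ hσ.continuous
  have hm : Measurable fun p : EuclideanSpace ℝ (Fin d) × EuclideanSpace ℝ (Fin d) =>
      ((Ω.indicator σ p.1 * h) ^ d)⁻¹ * η |‖p.1 - p.2‖ / (Ω.indicator σ p.1 * h)| := by
    have h1 : Measurable fun p : EuclideanSpace ℝ (Fin d) × EuclideanSpace ℝ (Fin d) =>
        Ω.indicator σ p.1 * h := (hσm.comp measurable_fst).mul_const h
    have h2 : Measurable fun p : EuclideanSpace ℝ (Fin d) × EuclideanSpace ℝ (Fin d) =>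
        |‖p.1 - p.2‖ / (Ω.indicator σ p.1 * h)| :=
      ((measurable_fst.sub measurable_snd).norm.div h1).abs
    exact (h1.pow_const d).inv.mul (hη.measurable_comp h2 fun _ => abs_nonneg _)
  refine (congrArg Measurable (funext ?_)).mp
    (hm.indicator (hΩ.measurableSet.prod hΩ.measurableSet))
  rintro ⟨x, y⟩
  simp only [Function.uncurry_apply_pair]
  by_cases hxy : x ∈ Ω ∧ y ∈ Ω
  · have hσ0 : 0 < σ x := hσ.min_pos.trans_le (hσ.lower x hxy.1)
    rw [degreeKernel_of_mem hxy.1 hxy.2, Set.indicator_of_mem (Set.mk_mem_prod hxy.1 hxy.2)]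
    simp only [Set.indicator_of_mem hxy.1]
    rw [abs_of_nonneg (by positivity), kernel]
  · rw [degreeKernel_of_notMem hxy, Set.indicator_of_notMem fun hc => hxy (Set.mem_prod.1 hc)]

lemma measurable_attractionKernel (hη : IsGraphKernel d η) (hΩ : IsOpen Ω)
    (hσ : IsBandwidth Ω σ σmin σmax) (hT : LipschitzOnWith L T Ω) (hh : 0 < h) :
    Measurable (Function.uncurry (attractionKernel Ω η σ h T L)) := by
  have hTm := measurable_indicator_of_continuousOn hΩ hT.continuousOn
  have hm : Measurable fun p : EuclideanSpace ℝ (Fin d) × EuclideanSpace ℝ (Fin d) =>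
      Real.log (1 + (h ^ 2)⁻¹ * ‖Ω.indicator T p.1 - Ω.indicator T p.2‖ ^ 2) / (L : ℝ) ^ 2 :=
    ((((((hTm.comp measurable_fst).sub (hTm.comp measurable_snd)).norm.pow_const 2).const_mul
      _).const_add 1).log).div_const _
  refine (congrArg Measurable (funext ?_)).mp ((measurable_degreeKernel hη hΩ hσ hh).mul hm)
  rintro ⟨x, y⟩
  simp only [Function.uncurry_apply_pair, Pi.mul_apply]
  by_cases hxy : x ∈ Ω ∧ y ∈ Ω
  · rw [degreeKernel_of_mem hxy.1 hxy.2, attractionKernel_of_mem hxy.1 hxy.2,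
      Set.indicator_of_mem hxy.1, Set.indicator_of_mem hxy.2, logInteraction]
  · rw [degreeKernel_of_notMem hxy, attractionKernel_of_notMem hxy, zero_mul]

lemma degreeKernel_nonneg (hη : IsGraphKernel d η) (hσ : IsBandwidth Ω σ σmin σmax) (hh : 0 < h)
    (x y : EuclideanSpace ℝ (Fin d)) : 0 ≤ degreeKernel Ω η σ h x y := by
  by_cases hxy : x ∈ Ω ∧ y ∈ Ω
  · have hσ0 : 0 < σ x := hσ.min_pos.trans_le (hσ.lower x hxy.1)
    rw [degreeKernel_of_mem hxy.1 hxy.2]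
    exact hη.kernel_nonneg (by positivity) (norm_nonneg _)
  · rw [degreeKernel_of_notMem hxy]

lemma attractionKernel_nonneg (hη : IsGraphKernel d η) (hσ : IsBandwidth Ω σ σmin σmax)
    (hh : 0 < h) (x y : EuclideanSpace ℝ (Fin d)) : 0 ≤ attractionKernel Ω η σ h T L x y := by
  by_cases hxy : x ∈ Ω ∧ y ∈ Ω
  · have hσ0 : 0 < σ x := hσ.min_pos.trans_le (hσ.lower x hxy.1)
    rw [attractionKernel_of_mem hxy.1 hxy.2]
    exact mul_nonneg (hη.kernel_nonneg (by positivity) (norm_nonneg _))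
      (div_nonneg (logInteraction_nonneg h T x y) (by positivity))
  · rw [attractionKernel_of_notMem hxy]

lemma degreeKernel_le (hη : IsGraphKernel d η) (hσ : IsBandwidth Ω σ σmin σmax) (hh : 0 < h)
    {B : ℝ} (hB0 : 0 ≤ B) (hB : ∀ t, 0 ≤ t → η t * (1 + t ^ 2) ≤ B)
    (x y : EuclideanSpace ℝ (Fin d)) :
    degreeKernel Ω η σ h x y ≤ (σmin ^ d)⁻¹ * B * (1 + σmax ^ 2) / h ^ d := by
  have hσm := hσ.min_pos
  by_cases hxy : x ∈ Ω ∧ y ∈ Ω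
  · have hσl := hσ.lower x hxy.1
    have hσ0 : 0 < σ x := hσm.trans_le hσl
    have hη0 := hη.zero_pos
    rw [degreeKernel_of_mem hxy.1 hxy.2]
    have hB' : η 0 ≤ B := by simpa using hB 0 le_rfl
    calc _ ≤ ((σ x * h) ^ d)⁻¹ * η 0 := hη.kernel_le (by positivity) (norm_nonneg _)
      _ ≤ ((σmin * h) ^ d)⁻¹ * B := by gcongr
      _ = (σmin ^ d)⁻¹ * B * 1 / h ^ d := by rw [mul_pow, mul_inv]; ring
      _ ≤ _ := by gcongr; linarith [sq_nonneg σmax]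
  · rw [degreeKernel_of_notMem hxy]; positivity

lemma attractionKernel_le (hη : IsGraphKernel d η) (hσ : IsBandwidth Ω σ σmin σmax)
    (hT : LipschitzOnWith L T Ω) (hh : 0 < h)
    {B : ℝ} (hB0 : 0 ≤ B) (hB : ∀ t, 0 ≤ t → η t * (1 + t ^ 2) ≤ B)
    (x y : EuclideanSpace ℝ (Fin d)) :
    attractionKernel Ω η σ h T L x y ≤ (σmin ^ d)⁻¹ * B * (1 + σmax ^ 2) / h ^ d := by
  have hσm := hσ.min_pos
  by_cases hxy : x ∈ Ω ∧ y ∈ Ω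
  · have hσl := hσ.lower x hxy.1
    have hσ0 : 0 < σ x := hσm.trans_le hσl
    have hσu := hσ.upper x hxy.1
    rw [attractionKernel_of_mem hxy.1 hxy.2]
    set t := ‖x - y‖ / (σ x * h) with ht
    have ht0 : 0 ≤ t := by positivity
    have hηt := hη.nonneg t ht0
    have hth : ‖x - y‖ / h = σ x * t := by rw [ht]; field_simp
    calc _ ≤ kernel d η (σ x * h) ‖x - y‖ * (‖x - y‖ / h) ^ 2 :=
          mul_le_mul_of_nonneg_left (logInteraction_div_le hT hxy.1 hxy.2)
            (hη.kernel_nonneg (by positivity) (norm_nonneg _))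
      _ = ((σ x * h) ^ d)⁻¹ * (η t * t ^ 2) * σ x ^ 2 := by rw [kernel, ← ht, hth]; ring
      _ ≤ ((σmin * h) ^ d)⁻¹ * B * σmax ^ 2 := by
          have : η t * t ^ 2 ≤ B := by linarith [hB t ht0]
          gcongr
      _ = (σmin ^ d)⁻¹ * B * σmax ^ 2 / h ^ d := by rw [mul_pow, mul_inv]; ring
      _ ≤ _ := by gcongr; linarith
  · rw [attractionKernel_of_notMem hxy]; positivity

lemma integral_degreeKernel (hΩ : IsOpen Ω) (hρ : IsDataDensity Ω ρ ρmin ρmax)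
    {x : EuclideanSpace ℝ (Fin d)} (hx : x ∈ Ω) :
    ∫ y, degreeKernel Ω η σ h x y ∂(dataLaw Ω ρ) = meanDegree Ω ρ η σ h x := by
  rw [integral_dataLaw hΩ hρ, meanDegree]
  exact setIntegral_congr_fun hΩ.measurableSet fun y hy => by
    simp only [degreeKernel_of_mem hx hy]

lemma integral_attractionKernel (hΩ : IsOpen Ω) (hρ : IsDataDensity Ω ρ ρmin ρmax)
    {x : EuclideanSpace ℝ (Fin d)} (hx : x ∈ Ω) :
    ∫ y, attractionKernel Ω η σ h T L x y ∂(dataLaw Ω ρ) =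
      meanAttraction Ω ρ η σ h T x / L ^ 2 := by
  rw [integral_dataLaw hΩ hρ, meanAttraction, ← integral_div]
  exact setIntegral_congr_fun hΩ.measurableSet fun y hy => by
    simp only [attractionKernel_of_mem hx hy]
    ring

lemma meanAttraction_div_le (hη : IsGraphKernel d η) (hΩ : IsOpen Ω)
    (hρ : IsDataDensity Ω ρ ρmin ρmax) (hσ : IsBandwidth Ω σ σmin σmax)
    (hT : LipschitzOnWith L T Ω) (hh : 0 < h) {x : EuclideanSpace ℝ (Fin d)} (hx : x ∈ Ω) :
    meanAttraction Ω ρ η σ h T x / L ^ 2 ≤ σmax ^ 2 * ρmax * polyMoment d η := by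
  have h1 := hρ.max_nonneg hx
  have h2 := hη.polyMoment_nonneg
  refine div_le_of_le_mul₀ (by positivity) (by positivity) ?_
  rw [mul_comm]
  exact meanAttraction_le hη hΩ hρ hσ hT hh hx

lemma sq_mul_meanAttraction_div (hη : IsGraphKernel d η) (hΩ : IsOpen Ω)
    (hρ : IsDataDensity Ω ρ ρmin ρmax) (hσ : IsBandwidth Ω σ σmin σmax)
    (hT : LipschitzOnWith L T Ω) (hh : 0 < h) {x : EuclideanSpace ℝ (Fin d)} (hx : x ∈ Ω) :
    (L : ℝ) ^ 2 * (meanAttraction Ω ρ η σ h T x / L ^ 2) = meanAttraction Ω ρ η σ h T x := by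
  rcases eq_or_ne L 0 with rfl | hL
  · have h1 := meanAttraction_le hη hΩ hρ hσ hT hh hx
    have h2 := meanAttraction_nonneg (T := T) hη hΩ hρ hσ hh hx
    simp only [NNReal.coe_zero, ne_eq, OfNat.ofNat_ne_zero, not_false_eq_true, zero_pow,
      zero_mul] at h1 ⊢
    linarith
  · have : (L : ℝ) ≠ 0 := by exact_mod_cast hL
    field_simp

end Kernels

/-! ### From the empirical to the continuum attraction -/

section Assembly

variable {d m : ℕ} {Ω : Set (EuclideanSpace ℝ (Fin d))} {ρ σ : EuclideanSpace ℝ (Fin d) → ℝ}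
  {η : ℝ → ℝ} {ρmin ρmax σmin σmax : ℝ}
  {T : EuclideanSpace ℝ (Fin d) → EuclideanSpace ℝ (Fin m)} {L L' : ℝ≥0} {h : ℝ}

/-- The normalized nonlocal attraction density, the quotient of the conditional means of the two
kernels. Off `Ω` it takes the value `0 / 0 = 0`. -/
noncomputable def attractionRatio (Ω : Set (EuclideanSpace ℝ (Fin d)))
    (ρ : EuclideanSpace ℝ (Fin d) → ℝ) (η : ℝ → ℝ) (σ : EuclideanSpace ℝ (Fin d) → ℝ) (h : ℝ)
    (T : EuclideanSpace ℝ (Fin d) → EuclideanSpace ℝ (Fin m)) (L : ℝ≥0)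
    (x : EuclideanSpace ℝ (Fin d)) : ℝ :=
  (∫ y, attractionKernel Ω η σ h T L x y ∂(dataLaw Ω ρ)) /
    ∫ y, degreeKernel Ω η σ h x y ∂(dataLaw Ω ρ)

lemma measurable_attractionRatio (hη : IsGraphKernel d η) (hΩ : IsOpen Ω)
    (hρ : IsDataDensity Ω ρ ρmin ρmax) (hσ : IsBandwidth Ω σ σmin σmax)
    (hT : LipschitzOnWith L T Ω) (hh : 0 < h) :
    Measurable (attractionRatio Ω ρ η σ h T L) := by
  have := isProbabilityMeasure_dataLaw hΩ hρ
  exact ((measurable_attractionKernel hη hΩ hσ hT hh).stronglyMeasurable.integral_prod_right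
    (ν := dataLaw Ω ρ)).measurable.div
    ((measurable_degreeKernel hη hΩ hσ hh).stronglyMeasurable.integral_prod_right
    (ν := dataLaw Ω ρ)).measurable

lemma attractionRatio_nonneg (hη : IsGraphKernel d η) (hσ : IsBandwidth Ω σ σmin σmax)
    (hh : 0 < h) (x : EuclideanSpace ℝ (Fin d)) : 0 ≤ attractionRatio Ω ρ η σ h T L x :=
  div_nonneg (integral_nonneg fun y => attractionKernel_nonneg hη hσ hh x y)
    (integral_nonneg fun y => degreeKernel_nonneg hη hσ hh x y)

lemma attractionRatio_le (hη : IsGraphKernel d η) (hΩ : IsOpen Ω)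
    (hρ : IsDataDensity Ω ρ ρmin ρmax) (hσ : IsBandwidth Ω σ σmin σmax)
    (hT : LipschitzOnWith L T Ω) (hh : 0 < h) (hρmax : 0 ≤ ρmax) {c₀ : ℝ} (hc₀ : 0 < c₀)
    (hD : ∀ x ∈ Ω, c₀ ≤ meanDegree Ω ρ η σ h x) (x : EuclideanSpace ℝ (Fin d)) :
    attractionRatio Ω ρ η σ h T L x ≤ σmax ^ 2 * ρmax * polyMoment d η / c₀ := by
  have hM := hη.polyMoment_nonneg
  by_cases hx : x ∈ Ω
  · rw [attractionRatio, integral_attractionKernel hΩ hρ hx, integral_degreeKernel hΩ hρ hx]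
    exact div_le_div₀ (by positivity) (meanAttraction_div_le hη hΩ hρ hσ hT hh hx) hc₀ (hD x hx)
  · have : attractionRatio Ω ρ η σ h T L x = 0 := by
      simp [attractionRatio, attractionKernel_of_notMem (fun hc => hx hc.1 : ¬(x ∈ Ω ∧ _))]
    rw [this]
    positivity

lemma sq_mul_attractionRatio (hη : IsGraphKernel d η) (hΩ : IsOpen Ω)
    (hρ : IsDataDensity Ω ρ ρmin ρmax) (hσ : IsBandwidth Ω σ σmin σmax)
    (hT : LipschitzOnWith L T Ω) (hh : 0 < h) {x : EuclideanSpace ℝ (Fin d)} (hx : x ∈ Ω) :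
    (L : ℝ) ^ 2 * attractionRatio Ω ρ η σ h T L x =
      meanAttraction Ω ρ η σ h T x / meanDegree Ω ρ η σ h x := by
  rw [attractionRatio, integral_attractionKernel hΩ hρ hx, integral_degreeKernel hΩ hρ hx,
    ← mul_div_assoc, sq_mul_meanAttraction_div hη hΩ hρ hσ hT hh hx]

lemma continuousOn_Phi_smul_fderiv (hη : IsGraphKernel d η) (hΩ : IsOpen Ω)
    (hσ : IsBandwidth Ω σ σmin σmax) (hd : DifferentiableOn ℝ T Ω) (hT : LipschitzOnWith L T Ω)
    (hDT : LipschitzOnWith L' (fderiv ℝ T) Ω) :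
    ContinuousOn (fun x => Phi η 1 (σ x • fderiv ℝ T x)) Ω := by
  simp only [Phi, one_pow, inv_one]
  refine continuousOn_of_dominated
    (bound := fun z => L ^ 2 * σmax ^ 2 * (η ‖z‖ * (1 + ‖z‖) ^ 4)) ?_ ?_ ?_ ?_
  · intro x hx
    have : Measurable fun z => Real.log (1 + ‖(σ x • fderiv ℝ T x) z‖ ^ 2) := by fun_prop
    exact (hη.measurable_eta_norm.mul this).aestronglyMeasurable
  · refine fun x hx => Filter.Eventually.of_forall fun z => ?_
    have h0 := log_one_add_nonneg (sq_nonneg ‖(σ x • fderiv ℝ T x) z‖)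
    have hz := hη.eta_nonneg z
    rw [Real.norm_eq_abs, abs_of_nonneg (mul_nonneg hz h0)]
    have := mul_le_mul_of_nonneg_left ((log_linearized_le hΩ hσ hd hT hx z).trans
      (sq_mul_norm_le_poly L σmax z)) hz
    linarith
  · exact hη.integrable_poly.const_mul _
  · refine Filter.Eventually.of_forall fun z => ?_
    have h1 : ContinuousOn (fun x => (σ x • fderiv ℝ T x) z) Ω :=
      (hσ.continuous.smul hDT.continuousOn).clm_apply continuousOn_const
    refine continuousOn_const.mul (ContinuousOn.log ?_ fun x _ => ne_of_gt (by positivity))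
    fun_prop

/-- The mean of the nonlocal attraction density agrees with the continuum attraction up to `O(h)`:
the boundary weight has integral `O(h)` over `Ω`. -/
lemma exists_abs_integral_attractionRatio_sub_le (hη : IsGraphKernel d η) (hΩ : IsOpen Ω)
    (hb : Bornology.IsBounded Ω) (hne : Ωᶜ.Nonempty) (hlip : HasLipschitzBoundary Ω)
    (hρ : IsDataDensity Ω ρ ρmin ρmax) (hρmax : 0 ≤ ρmax) (hσ : IsBandwidth Ω σ σmin σmax)
    {c₀ : ℝ} (hc₀ : 0 < c₀) :
    ∃ C : ℝ, 0 ≤ C ∧ ∀ (T : EuclideanSpace ℝ (Fin d) → EuclideanSpace ℝ (Fin m)) (L L' : ℝ≥0),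
      DifferentiableOn ℝ T Ω → LipschitzOnWith L T Ω → LipschitzOnWith L' (fderiv ℝ T) Ω →
      ∀ h, 0 < h → (∀ x ∈ Ω, c₀ ≤ meanDegree Ω ρ η σ h x) →
        |(L : ℝ) ^ 2 * ∫ x, attractionRatio Ω ρ η σ h T L x ∂(dataLaw Ω ρ) -
            continuumAttraction Ω ρ η σ 1 T| ≤ C * ((L : ℝ) ^ 2 + (L' : ℝ) ^ 2) * h := by
  obtain ⟨C₁, hC₁, hpt⟩ := exists_abs_div_sub_Phi_le (m := m) hη hΩ hne hρ hσ hc₀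
  obtain ⟨C₂, hC₂, hlayer⟩ := exists_volume_layer_le hΩ hb hne hlip
  refine ⟨C₁ * (1 + ρmax * (2 * C₂)), by positivity, fun T L L' hd hT hDT h hh hD => ?_⟩
  have hfin : IsFiniteMeasure (volume.restrict Ω) := ⟨by simpa using hb.measure_lt_top⟩
  set Q := (L : ℝ) ^ 2 + (L' : ℝ) ^ 2 with hQ
  have hQ0 : 0 ≤ Q := by positivity
  have hρm : AEStronglyMeasurable ρ (volume.restrict Ω) :=
    (hρ.aemeasurable hΩ).aestronglyMeasurable
  have hM := hη.polyMoment_nonneg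
  have hi1 : IntegrableOn (fun x => (L : ℝ) ^ 2 * attractionRatio Ω ρ η σ h T L x * ρ x) Ω := by
    refine hρ.integrableOn.bdd_mul (c := L ^ 2 * (σmax ^ 2 * ρmax * polyMoment d η / c₀))
      ((measurable_attractionRatio hη hΩ hρ hσ hT hh).const_mul _).aestronglyMeasurable
      (Filter.Eventually.of_forall fun x => ?_)
    have h0 : 0 ≤ attractionRatio Ω ρ η σ h T L x := attractionRatio_nonneg hη hσ hh x
    rw [Real.norm_eq_abs, abs_of_nonneg (by positivity)]
    exact mul_le_mul_of_nonneg_left (attractionRatio_le hη hΩ hρ hσ hT hh hρmax hc₀ hD x)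
      (by positivity)
  have hi2 : IntegrableOn (fun x => Phi η 1 (σ x • fderiv ℝ T x) * ρ x) Ω := by
    refine hρ.integrableOn.bdd_mul (c := L ^ 2 * σmax ^ 2 * polyMoment d η)
      ((continuousOn_Phi_smul_fderiv hη hΩ hσ hd hT hDT).aestronglyMeasurable hΩ.measurableSet)
      ((ae_restrict_iff' hΩ.measurableSet).2 (Filter.Eventually.of_forall fun x hx => ?_))
    rw [Real.norm_eq_abs, abs_of_nonneg (Phi_one_nonneg hη _)]
    exact Phi_smul_fderiv_le hη hΩ hσ hd hT hx
  have hwi : IntegrableOn (fun x => layerWeight Ω h x) Ω :=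
    Integrable.of_bound (measurable_layerWeight h).aestronglyMeasurable 1
      (Filter.Eventually.of_forall fun x => by
        rw [Real.norm_eq_abs, abs_of_nonneg (layerWeight_nonneg h x)]
        exact layerWeight_le_one h x)
  have hgi : IntegrableOn (fun x => C₁ * Q * (h * ρ x + ρmax * layerWeight Ω h x)) Ω :=
    ((hρ.integrableOn.const_mul h).add (hwi.const_mul ρmax)).const_mul _
  rw [integral_dataLaw hΩ hρ, ← integral_const_mul, continuumAttraction]
  simp_rw [← mul_assoc]
  rw [← integral_sub hi1 hi2, ← Real.norm_eq_abs]
  calc _ ≤ ∫ x in Ω, C₁ * Q * (h * ρ x + ρmax * layerWeight Ω h x) := by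
        refine norm_integral_le_of_norm_le hgi
          ((ae_restrict_iff' hΩ.measurableSet).2 (Filter.Eventually.of_forall fun x hx => ?_))
        have hρx := hρ.nonneg hx
        have hw := layerWeight_nonneg (Ω := Ω) h x
        rw [← sub_mul, sq_mul_attractionRatio hη hΩ hρ hσ hT hh hx, Real.norm_eq_abs, abs_mul,
          abs_of_nonneg hρx]
        calc _ ≤ C₁ * Q * (h + layerWeight Ω h x) * ρ x := by
              gcongr
              exact hpt T L L' hd hT hDT h hh x hx (hD x hx)
          _ = C₁ * Q * (h * ρ x + ρ x * layerWeight Ω h x) := by ring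
          _ ≤ _ := by
              gcongr
              exact hρ.upper x hx
    _ = C₁ * Q * (h * 1 + ρmax * ∫ x in Ω, layerWeight Ω h x) := by
        rw [integral_const_mul, integral_add (hρ.integrableOn.const_mul h) (hwi.const_mul ρmax),
          integral_const_mul, integral_const_mul, hρ.mass_one]
    _ ≤ C₁ * Q * (h * 1 + ρmax * (2 * C₂ * h)) := by
        gcongr
        exact setIntegral_layerWeight_le hΩ hne hC₂ hlayer hh
    _ = _ := by ring

/-- Stability of a quotient of sums under the relative deviations of its two parts. -/
lemma abs_div_sub_div_le {S D' N D n ε c₀ C : ℝ} (hn : 0 < n) (hc₀ : 0 < c₀) (hD : c₀ ≤ D)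
    (hN0 : 0 ≤ N) (hN : N ≤ C) (hε : ε ≤ c₀ / 2) (hD' : |D' - n * D| ≤ n * ε)
    (hS : |S - n * N| ≤ n * ε) : |S / D' - N / D| ≤ (2 / c₀ + 2 * C / c₀ ^ 2) * ε := by
  have hε0 : 0 ≤ ε := nonneg_of_mul_nonneg_right ((abs_nonneg _).trans hS) hn
  have hD'low : n * (c₀ / 2) ≤ D' := by
    have h1 := (abs_le.1 hD').1
    nlinarith
  have hD'pos : 0 < D' := lt_of_lt_of_le (by positivity) hD'low
  have hDpos : 0 < D := hc₀.trans_le hD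
  have hC : 0 ≤ C := hN0.trans hN
  have heq : S / D' - N / D = (S - n * N) / D' - N * (D' - n * D) / (D' * D) := by
    field_simp; ring
  rw [heq]
  calc _ ≤ |(S - n * N) / D'| + |N * (D' - n * D) / (D' * D)| := abs_sub _ _
    _ = |S - n * N| / D' + N * |D' - n * D| / (D' * D) := by
        rw [abs_div, abs_div, abs_mul, abs_of_pos hD'pos, abs_of_nonneg hN0,
          abs_of_pos (mul_pos hD'pos hDpos)]
    _ ≤ n * ε / (n * (c₀ / 2)) + C * (n * ε) / (n * (c₀ / 2) * c₀) := by gcongr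
    _ = _ := by field_simp

lemma degree_eq_sum {n : ℕ} {x : Fin n → EuclideanSpace ℝ (Fin d)} (hx : ∀ i, x i ∈ Ω)
    (i : Fin n) : degree η σ h x i = ∑ j, degreeKernel Ω η σ h (x i) (x j) :=
  Finset.sum_congr rfl fun j _ => (degreeKernel_of_mem (hx i) (hx j)).symm

lemma discreteAttraction_eq (hT : LipschitzOnWith L T Ω) {n : ℕ}
    {x : Fin n → EuclideanSpace ℝ (Fin d)} (hx : ∀ i, x i ∈ Ω) :
    discreteAttraction η σ h T x = (L : ℝ) ^ 2 * ((1 / (n : ℝ)) * ∑ i,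
      (∑ j, attractionKernel Ω η σ h T L (x i) (x j)) /
        ∑ j, degreeKernel Ω η σ h (x i) (x j)) := by
  rw [discreteAttraction, mul_left_comm, Finset.mul_sum _ _ ((L : ℝ) ^ 2)]
  congr 1
  refine Finset.sum_congr rfl fun i _ => ?_
  rw [degree_eq_sum hx i, one_div_mul_eq_div, ← mul_div_assoc, Finset.mul_sum]
  congr 1
  refine Finset.sum_congr rfl fun j _ => ?_
  rw [attractionKernel_of_mem (hx i) (hx j), mul_left_comm,
    sq_mul_logInteraction_div hT (hx i) (hx j), logInteraction]

/-- The discrete attraction is close to the mean of the nonlocal attraction density as soon as the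
degrees, the row sums and the sample mean all deviate by at most `ε`. -/
lemma abs_discreteAttraction_sub_le (hη : IsGraphKernel d η) (hΩ : IsOpen Ω)
    (hρ : IsDataDensity Ω ρ ρmin ρmax) (hσ : IsBandwidth Ω σ σmin σmax)
    (hT : LipschitzOnWith L T Ω) (hh : 0 < h) {c₀ : ℝ} (hc₀ : 0 < c₀)
    (hD : ∀ x ∈ Ω, c₀ ≤ meanDegree Ω ρ η σ h x) {n : ℕ} (hn : 0 < n) {ε : ℝ} (hε : ε ≤ c₀ / 2)
    {x : Fin n → EuclideanSpace ℝ (Fin d)} (hx : ∀ i, x i ∈ Ω)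
    (hdeg : ∀ i, |∑ j, degreeKernel Ω η σ h (x i) (x j) -
      n * ∫ y, degreeKernel Ω η σ h (x i) y ∂(dataLaw Ω ρ)| ≤ n * ε)
    (hatt : ∀ i, |∑ j, attractionKernel Ω η σ h T L (x i) (x j) -
      n * ∫ y, attractionKernel Ω η σ h T L (x i) y ∂(dataLaw Ω ρ)| ≤ n * ε)
    (hmean : |∑ i, attractionRatio Ω ρ η σ h T L (x i) -
      n * ∫ y, attractionRatio Ω ρ η σ h T L y ∂(dataLaw Ω ρ)| ≤ n * ε) :
    |discreteAttraction η σ h T x -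
        (L : ℝ) ^ 2 * ∫ y, attractionRatio Ω ρ η σ h T L y ∂(dataLaw Ω ρ)| ≤
      (L : ℝ) ^ 2 *
        ((2 / c₀ + 2 * (σmax ^ 2 * ρmax * polyMoment d η) / c₀ ^ 2 + 1) * ε) := by
  have hn' : (0 : ℝ) < n := by exact_mod_cast hn
  set K := 2 / c₀ + 2 * (σmax ^ 2 * ρmax * polyMoment d η) / c₀ ^ 2 with hK
  set I := ∫ y, attractionRatio Ω ρ η σ h T L y ∂(dataLaw Ω ρ) with hI
  rw [discreteAttraction_eq hT hx, ← mul_sub, abs_mul, abs_of_nonneg (sq_nonneg (L : ℝ))]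
  refine mul_le_mul_of_nonneg_left ?_ (sq_nonneg _)
  have hrow : ∀ i, |(∑ j, attractionKernel Ω η σ h T L (x i) (x j)) /
      (∑ j, degreeKernel Ω η σ h (x i) (x j)) - attractionRatio Ω ρ η σ h T L (x i)| ≤ K * ε := by
    intro i
    refine abs_div_sub_div_le hn' hc₀ ?_ ?_ ?_ hε (hdeg i) (hatt i)
    · rw [integral_degreeKernel hΩ hρ (hx i)]; exact hD _ (hx i)
    · exact integral_nonneg fun y => attractionKernel_nonneg hη hσ hh _ y
    · rw [integral_attractionKernel hΩ hρ (hx i)]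
      exact meanAttraction_div_le hη hΩ hρ hσ hT hh (hx i)
  have hsum : |∑ i, (∑ j, attractionKernel Ω η σ h T L (x i) (x j)) /
      (∑ j, degreeKernel Ω η σ h (x i) (x j)) -
        ∑ i, attractionRatio Ω ρ η σ h T L (x i)| ≤ n * (K * ε) := by
    rw [← Finset.sum_sub_distrib]
    refine (Finset.abs_sum_le_sum_abs _ _).trans ((Finset.sum_le_sum fun i _ => hrow i).trans ?_)
    simp
  have heq : ∀ s : ℝ, 1 / (n : ℝ) * s - I = (s - n * I) / n := fun s => by field_simp
  rw [heq, abs_div, abs_of_pos hn', div_le_iff₀ hn']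
  have := abs_sub_le (∑ i, (∑ j, attractionKernel Ω η σ h T L (x i) (x j)) /
      (∑ j, degreeKernel Ω η σ h (x i) (x j))) (∑ i, attractionRatio Ω ρ η σ h T L (x i)) (n * I)
  linarith

lemma tailMass_nonneg (hη : IsGraphKernel d η) (r : ℝ) : 0 ≤ tailMass d η r :=
  integral_nonneg fun z => hη.eta_nonneg z

/-- If i.i.d. data with law `dataLaw Ω ρ` satisfy a property for all samples in `Ω` outside a set of
small product measure, the property holds with high probability. Neither the exceptional set nor the
property needs to be measurable. -/
lemma one_sub_le_measureReal_of_pi (hΩ : IsOpen Ω) (hρ : IsDataDensity Ω ρ ρmin ρmax) {n : ℕ}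
    {S : Type*} [MeasurableSpace S] {P : Measure S} [IsProbabilityMeasure P]
    {X : Fin n → S → EuclideanSpace ℝ (Fin d)} (hX : ∀ i, Measurable (X i))
    (hlaw : ∀ i, P.map (X i) = dataLaw Ω ρ) (hind : iIndepFun X P)
    {B : Set (Fin n → EuclideanSpace ℝ (Fin d))} {δ : ℝ}
    (hB : (Measure.pi fun _ : Fin n => dataLaw Ω ρ).real B ≤ δ) {G : Set S}
    (hG : ∀ ω, (∀ i, X i ω ∈ Ω) → (fun i => X i ω) ∉ B → ω ∈ G) :
    1 - δ ≤ P.real G := by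
  have := isProbabilityMeasure_dataLaw hΩ hρ
  have hmap : P.map (fun ω i => X i ω) = Measure.pi fun _ : Fin n => dataLaw Ω ρ := by
    rw [(iIndepFun_iff_map_fun_eq_pi_map fun i => (hX i).aemeasurable).1 hind]
    simp_rw [hlaw]
  have hXm : Measurable fun ω i => X i ω := measurable_pi_lambda _ hX
  set A := toMeasurable (Measure.pi fun _ : Fin n => dataLaw Ω ρ) B with hA
  have hAm : MeasurableSet A := measurableSet_toMeasurable _ _
  have hAδ : P.real ((fun ω i => X i ω) ⁻¹' A) ≤ δ := by
    rw [measureReal_def, ← Measure.map_apply hXm hAm, hmap, hA, measure_toMeasurable]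
    exact hB
  have hin : ∀ᵐ ω ∂P, ∀ i, X i ω ∈ Ω := ae_all_iff.2 fun i => by
    refine ae_of_ae_map (hX i).aemeasurable ?_
    rw [hlaw]
    exact ae_mem_dataLaw hΩ
  have hsub : ((fun ω i => X i ω) ⁻¹' A)ᶜ ≤ᵐ[P] G := by
    filter_upwards [hin] with ω hω hωA
    exact hG ω hω fun hb => hωA (subset_toMeasurable _ _ hb)
  have h1 : P.real ((fun ω i => X i ω) ⁻¹' A)ᶜ ≤ P.real G :=
    ENNReal.toReal_mono (measure_ne_top _ _) (measure_mono_ae hsub)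
  rw [probReal_compl_eq_one_sub (hXm hAm)] at h1
  linarith

/-- Once the claimed failure probability `3 n exp(-lam²)` is below one, it exceeds that of the union
bound. -/
lemma union_bound_le {n : ℕ} {lam : ℝ} (hn : 2 ≤ n) (h1 : 3 * (n : ℝ) * Real.exp (-lam ^ 2) < 1) :
    (4 * n + 2) * Real.exp (-(2 * lam ^ 2)) ≤ 3 * (n : ℝ) * Real.exp (-lam ^ 2) := by
  have hn' : (2 : ℝ) ≤ n := by exact_mod_cast hn
  have he : Real.exp (-(2 * lam ^ 2)) = Real.exp (-lam ^ 2) * Real.exp (-lam ^ 2) := by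
    rw [← Real.exp_add]; ring_nf
  have hpos := Real.exp_pos (-lam ^ 2)
  rw [he, ← mul_assoc]
  refine mul_le_mul_of_nonneg_right ?_ hpos.le
  nlinarith

lemma one_le_of_mul_exp_lt {n : ℕ} {lam : ℝ} (hn : 2 ≤ n) (hlam : 0 ≤ lam)
    (h1 : 3 * (n : ℝ) * Real.exp (-lam ^ 2) < 1) : 1 ≤ lam := by
  by_contra! hlt
  have hn' : (2 : ℝ) ≤ n := by exact_mod_cast hn
  have h2 : Real.exp (-1) ≤ Real.exp (-lam ^ 2) := Real.exp_le_exp.2 (by nlinarith)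
  have h3 : 1 / 3 < Real.exp (-1) := by
    rw [Real.exp_neg, ← one_div]
    exact one_div_lt_one_div_of_lt (Real.exp_pos _) (by linarith [Real.exp_one_lt_d9])
  nlinarith

end Assembly

lemma compl_nonempty_of_isBounded {d : ℕ} [NeZero d] {Ω : Set (EuclideanSpace ℝ (Fin d))}
    (hb : Bornology.IsBounded Ω) : Ωᶜ.Nonempty := by
  rw [Set.nonempty_compl]
  rintro rfl
  exact NormedSpace.unbounded_univ ℝ (EuclideanSpace ℝ (Fin d)) hb

set_option maxHeartbeats 1000000 in
/-- Deterministic bounds and concentration combined, in positive dimension. -/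
lemma exists_concentration_of_neZero (d m : ℕ) [NeZero d]
    (Ω : Set (EuclideanSpace ℝ (Fin d))) (hΩ : IsOpen Ω)
    (hb : Bornology.IsBounded Ω) (hlip : HasLipschitzBoundary Ω)
    (ρ : EuclideanSpace ℝ (Fin d) → ℝ) (ρmin ρmax : ℝ) (hρ : IsDataDensity Ω ρ ρmin ρmax)
    (η : ℝ → ℝ) (hη : IsGraphKernel d η)
    (σ : EuclideanSpace ℝ (Fin d) → ℝ) (σmin σmax : ℝ) (hσ : IsBandwidth Ω σ σmin σmax) :
    ∃ C c : ℝ, 1 ≤ C ∧ 0 < c ∧ c ≤ 1 ∧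
      ∀ T : EuclideanSpace ℝ (Fin d) → EuclideanSpace ℝ (Fin m),
        DifferentiableOn ℝ T Ω → IsLipschitzOn T Ω → IsLipschitzOn (fderiv ℝ T) Ω →
      ∀ (n : ℕ) (h r lam : ℝ), 2 ≤ n → 0 < h → h ≤ c → C ≤ (n : ℝ) * h ^ d → h ≤ r →
        0 ≤ lam → lam ^ 2 ≤ c * ((n : ℝ) * h ^ d) →
      ∀ (S : Type*) [MeasurableSpace S] (P : Measure S) [IsProbabilityMeasure P]
        (X : Fin n → S → EuclideanSpace ℝ (Fin d)),
        (∀ i, Measurable (X i)) → (∀ i, P.map (X i) = dataLaw Ω ρ) → iIndepFun X P →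
        1 - 3 * (n : ℝ) * Real.exp (-lam ^ 2) ≤
          P.real {ω | |discreteAttraction η σ h T (fun i => X i ω) -
              continuumAttraction Ω ρ η σ 1 T| ≤
            C * ((lip T Ω : ℝ) ^ 2 + (lip (fderiv ℝ T) Ω : ℝ) ^ 2) *
              (lam / Real.sqrt ((n : ℝ) * h ^ d) +
                tailMass d η (r / (h * σmax)) + r)} := by
  have hne := compl_nonempty_of_isBounded hb
  have := isProbabilityMeasure_dataLaw hΩ hρ
  obtain ⟨x₀, hx₀⟩ : Ω.Nonempty := by
    rw [Set.nonempty_iff_ne_empty]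
    rintro rfl
    have := hρ.mass_one
    simp at this
  have hρmax := hρ.max_nonneg hx₀
  have hσmin := hσ.min_pos
  have hM := hη.polyMoment_nonneg
  obtain ⟨B, hB0, hB⟩ := hη.exists_le
  obtain ⟨c₀, h₀, hc₀, hh₀, hdeg⟩ := exists_le_meanDegree hη hΩ hb hlip hρ hσ
  obtain ⟨C₄, hC₄, hcont⟩ := exists_abs_integral_attractionRatio_sub_le (m := m) hη hΩ hb hne hlip
    hρ hρmax hσ hc₀
  -- `b₁ / h ^ d` bounds both kernels, `b₂` their means, and `C₂` the attraction ratio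
  set b₁ := (σmin ^ d)⁻¹ * B * (1 + σmax ^ 2) with hb₁
  set b₂ := ρmax * polyMoment d η * (1 + σmax ^ 2) with hb₂
  set C₂ := σmax ^ 2 * ρmax * polyMoment d η / c₀ with hC₂
  have hb₁0 : 0 ≤ b₁ := by positivity
  have hb₂0 : 0 ≤ b₂ := by positivity
  have hC₂0 : 0 ≤ C₂ := by positivity
  set C₁ := b₁ + b₁ * b₂ + C₂ + C₂ ^ 2 with hC₁
  have hbb : 0 ≤ b₁ * b₂ := by positivity
  have hCC : 0 ≤ C₂ ^ 2 := by positivity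
  have hC₁0 : 0 ≤ C₁ := by positivity
  set K := 2 / c₀ + 2 * (σmax ^ 2 * ρmax * polyMoment d η) / c₀ ^ 2 + 1 with hK
  have hK0 : 0 ≤ K := by positivity
  set c := min (min 1 h₀) (min (1 / (1 + C₁) ^ 2) ((c₀ / (4 * C₁ + 4)) ^ 2)) with hc
  have hcpos : 0 < c := by positivity
  have hc1 : c ≤ 1 := (min_le_left _ _).trans (min_le_left _ _)
  have hch : c ≤ h₀ := (min_le_left _ _).trans (min_le_right _ _)
  have hcC : c ≤ 1 / (1 + C₁) ^ 2 := (min_le_right _ _).trans (min_le_left _ _)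
  have hcε : c ≤ (c₀ / (4 * C₁ + 4)) ^ 2 := (min_le_right _ _).trans (min_le_right _ _)
  have hKC : 0 ≤ K * (2 * C₁ + 2) := by positivity
  refine ⟨1 + K * (2 * C₁ + 2) + C₄, c, by linarith, hcpos, hc1, ?_⟩
  intro T hd hTl hDTl n h r lam hn hh hhc hCn hhr hlam hlamc S _ P _ X hX hlaw hind
  rcases le_or_gt 1 (3 * (n : ℝ) * Real.exp (-lam ^ 2)) with htriv | hsmall
  · have : 0 ≤ P.real {ω | |discreteAttraction η σ h T (fun i => X i ω) -
              continuumAttraction Ω ρ η σ 1 T| ≤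
            (1 + K * (2 * C₁ + 2) + C₄) *
              ((lip T Ω : ℝ) ^ 2 + (lip (fderiv ℝ T) Ω : ℝ) ^ 2) *
              (lam / Real.sqrt ((n : ℝ) * h ^ d) +
                tailMass d η (r / (h * σmax)) + r)} := measureReal_nonneg
    linarith
  have hlam1 := one_le_of_mul_exp_lt hn hlam hsmall
  have hT := hTl.lipschitzOnWith_lip
  have hDT := hDTl.lipschitzOnWith_lip
  set L := lip T Ω
  set L' := lip (fderiv ℝ T) Ω
  have hH : 0 < h ^ d := by positivity
  have hH1 : h ^ d ≤ 1 := pow_le_one₀ hh.le (hhc.trans hc1)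
  have hq : 1 ≤ (n : ℝ) * h ^ d := by linarith
  have hq0 : 0 < (n : ℝ) * h ^ d := by linarith
  have hD : ∀ x ∈ Ω, c₀ ≤ meanDegree Ω ρ η σ h x := hdeg h hh (hhc.trans hch)
  have hlamq : C₁ ^ 2 * lam ^ 2 ≤ n * h ^ d := by
    have h1 : (1 + C₁) ^ 2 * c ≤ 1 := by
      rw [le_div_iff₀ (by positivity)] at hcC; linarith
    calc C₁ ^ 2 * lam ^ 2 ≤ (1 + C₁) ^ 2 * (c * (n * h ^ d)) := by
          gcongr
          linarith
      _ = (1 + C₁) ^ 2 * c * (n * h ^ d) := by ring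
      _ ≤ 1 * (n * h ^ d) := by gcongr
      _ = _ := one_mul _
  set e := lam / Real.sqrt ((n : ℝ) * h ^ d) with he
  have he0 : 0 ≤ e := by positivity
  have hec : e ≤ c₀ / (4 * C₁ + 4) := by
    refine le_of_sq_le_sq ?_ (by positivity)
    rw [he, div_pow, Real.sq_sqrt hq0.le]
    exact ((div_le_iff₀ hq0).2 hlamc).trans hcε
  set ε := (2 * C₁ + 2) * e with hε
  have hεc : ε ≤ c₀ / 2 := by
    calc ε ≤ (2 * C₁ + 2) * (c₀ / (4 * C₁ + 4)) := by rw [hε]; gcongr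
      _ = c₀ / 2 := by field_simp; ring
  have hbC : b₁ / h ^ d ≤ C₁ / h ^ d := by gcongr; linarith
  have hbV : b₁ / h ^ d * b₂ ≤ C₁ / h ^ d := by
    rw [div_mul_eq_mul_div]; gcongr; linarith
  have hmean_deg : ∀ x, ∫ y, degreeKernel Ω η σ h x y ∂(dataLaw Ω ρ) ≤ b₂ := fun x => by
    by_cases hx : x ∈ Ω
    · rw [integral_degreeKernel hΩ hρ hx]
      refine (meanDegree_le hη hΩ hρ hσ hh hx).trans (le_mul_of_one_le_right (by positivity) ?_)
      linarith [sq_nonneg σmax]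
    · simpa [degreeKernel_of_notMem (fun hc => hx hc.1 : ¬(x ∈ Ω ∧ _))] using hb₂0
  have hmean_att : ∀ x, ∫ y, attractionKernel Ω η σ h T L x y ∂(dataLaw Ω ρ) ≤ b₂ := fun x => by
    by_cases hx : x ∈ Ω
    · rw [integral_attractionKernel hΩ hρ hx]
      refine (meanAttraction_div_le hη hΩ hρ hσ hT hh hx).trans ?_
      have : 0 ≤ ρmax * polyMoment d η := by positivity
      linarith
    · simpa [attractionKernel_of_notMem (fun hc => hx hc.1 : ¬(x ∈ Ω ∧ _))] using hb₂0
  have hdm := measurable_degreeKernel hη hΩ hσ hh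
  have ham := measurable_attractionKernel hη hΩ hσ hT hh
  have hfm := measurable_attractionRatio hη hΩ hρ hσ hT hh
  have hd0 := degreeKernel_nonneg hη hσ hh
  have ha0 := attractionKernel_nonneg (T := T) (L := L) hη hσ hh
  have hf0 := attractionRatio_nonneg (ρ := ρ) (T := T) (L := L) hη hσ hh
  have hdb := degreeKernel_le hη hσ hh hB0 hB
  have hab := attractionKernel_le hη hσ hT hh hB0 hB
  have hfb := attractionRatio_le hη hΩ hρ hσ hT hh hρmax hc₀ hD
  have hfmean : ∫ x, attractionRatio Ω ρ η σ h T L x ∂(dataLaw Ω ρ) ≤ C₂ := by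
    refine (integral_mono (integrable_of_abs_le hfm (M := C₂) fun x => ?_)
      (integrable_const C₂) hfb).trans (by simp)
    rw [abs_of_nonneg (hf0 x)]; exact hfb x
  have hbad := measureReal_exists_deviation_le (μ := dataLaw Ω ρ) hdm ham hfm
    hd0 (fun x y => (hdb x y).trans hbC)
    (fun x => (integral_sq_le (hdm.comp measurable_prodMk_left) (hd0 x) (hdb x) (by positivity)
      (hmean_deg x)).trans hbV)
    ha0 (fun x y => (hab x y).trans hbC)
    (fun x => (integral_sq_le (ham.comp measurable_prodMk_left) (ha0 x) (hab x) (by positivity)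
      (hmean_att x)).trans hbV)
    hf0 (fun x => (hfb x).trans (by linarith))
    ((integral_sq_le hfm hf0 hfb hC₂0 hfmean).trans (by linarith [sq C₂]))
    hC₁0 hH hH1 hq hlam1 hlamq hε
  refine one_sub_le_measureReal_of_pi hΩ hρ hX hlaw hind
    (hbad.trans (union_bound_le hn hsmall)) fun ω hω hgood => ?_
  rw [Set.mem_ofPred_eq, not_or, not_or] at hgood
  obtain ⟨hg1, hg2, hg3⟩ := hgood
  push Not at hg1 hg2 hg3
  have h1 := abs_discreteAttraction_sub_le hη hΩ hρ hσ hT hh hc₀ hD (by omega) hεc hω hg1 hg2 hg3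
  have h2 := hcont T L L' hd hT hDT h hh hD
  have h3 := tailMass_nonneg hη (r / (h * σmax))
  have hr0 : 0 ≤ r := hh.le.trans hhr
  rw [Set.mem_ofPred_eq]
  set Q := (L : ℝ) ^ 2 + (L' : ℝ) ^ 2 with hQ
  have hQ0 : 0 ≤ Q := by positivity
  have hLQ : (L : ℝ) ^ 2 ≤ Q := by rw [hQ]; linarith [sq_nonneg (L' : ℝ)]
  calc _ ≤ _ := abs_sub_le _ _ _
    _ ≤ (L : ℝ) ^ 2 * (K * ε) + C₄ * Q * h := add_le_add h1 h2
    _ ≤ Q * (K * ε) + C₄ * Q * r := by gcongr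
    _ = (K * (2 * C₁ + 2)) * Q * e + C₄ * Q * r := by rw [hε]; ring
    _ ≤ (1 + K * (2 * C₁ + 2) + C₄) * Q * e + (1 + K * (2 * C₁ + 2) + C₄) * Q * r := by
        gcongr <;> linarith
    _ = (1 + K * (2 * C₁ + 2) + C₄) * Q * (e + r) := by ring
    _ ≤ _ := by
        gcongr
        linarith

/-- In dimension zero all points coincide, and both attractions vanish. -/
lemma attraction_eq_zero_of_dim_zero {m n : ℕ} (Ω : Set (EuclideanSpace ℝ (Fin 0)))
    (ρ : EuclideanSpace ℝ (Fin 0) → ℝ) (η : ℝ → ℝ) (σ : EuclideanSpace ℝ (Fin 0) → ℝ) (h : ℝ)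
    (T : EuclideanSpace ℝ (Fin 0) → EuclideanSpace ℝ (Fin m))
    (x : Fin n → EuclideanSpace ℝ (Fin 0)) :
    discreteAttraction η σ h T x = 0 ∧ continuumAttraction Ω ρ η σ 1 T = 0 := by
  constructor
  · have : ∀ i j, T (x i) - T (x j) = 0 := fun i j => by rw [Subsingleton.elim (x i) (x j), sub_self]
    simp [discreteAttraction, this]
  · have : ∀ (A : EuclideanSpace ℝ (Fin 0) →L[ℝ] EuclideanSpace ℝ (Fin m)), Phi η 1 A = 0 := by
      intro A
      have h0 : ∀ z, A z = 0 := fun z => by rw [Subsingleton.elim z 0, map_zero]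
      simp [Phi, h0]
    simp [continuumAttraction, this]

end TSNE

theorem theorem2p4 (d m : ℕ)
    (Ω : Set (EuclideanSpace ℝ (Fin d))) (hΩ_open : IsOpen Ω)
    (hΩ_bdd : Bornology.IsBounded Ω) (hΩ_lip : TSNE.HasLipschitzBoundary Ω)
    (ρ : EuclideanSpace ℝ (Fin d) → ℝ) (ρmin ρmax : ℝ) (hρ : TSNE.IsDataDensity Ω ρ ρmin ρmax)
    (η : ℝ → ℝ) (hη : TSNE.IsGraphKernel d η)
    (σ : EuclideanSpace ℝ (Fin d) → ℝ) (σmin σmax : ℝ) (hσ : TSNE.IsBandwidth Ω σ σmin σmax) :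
    ∃ C c : ℝ, 1 ≤ C ∧ 0 < c ∧ c ≤ 1 ∧
      ∀ T : EuclideanSpace ℝ (Fin d) → EuclideanSpace ℝ (Fin m),
        DifferentiableOn ℝ T Ω → TSNE.IsLipschitzOn T Ω → TSNE.IsLipschitzOn (fderiv ℝ T) Ω →
      ∀ (n : ℕ) (h r lam : ℝ), 2 ≤ n → 0 < h → h ≤ c → C ≤ (n : ℝ) * h ^ d → h ≤ r →
        0 ≤ lam → lam ^ 2 ≤ c * ((n : ℝ) * h ^ d) →
      ∀ (S : Type*) [MeasurableSpace S] (P : Measure S) [IsProbabilityMeasure P]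
        (X : Fin n → S → EuclideanSpace ℝ (Fin d)),
        (∀ i, Measurable (X i)) → (∀ i, P.map (X i) = TSNE.dataLaw Ω ρ) → iIndepFun X P →
        1 - 3 * (n : ℝ) * Real.exp (-lam ^ 2) ≤
          P.real {ω | |TSNE.discreteAttraction η σ h T (fun i => X i ω) -
              TSNE.continuumAttraction Ω ρ η σ 1 T| ≤
            C * ((TSNE.lip T Ω : ℝ) ^ 2 + (TSNE.lip (fderiv ℝ T) Ω : ℝ) ^ 2) *
              (lam / Real.sqrt ((n : ℝ) * h ^ d) +
                TSNE.tailMass d η (r / (h * σmax)) + r)} := by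
  rcases eq_or_ne d 0 with rfl | hd
  · refine ⟨1, 1, le_rfl, one_pos, le_rfl, ?_⟩
    intro T _ _ _ n h r lam _ hh _ _ hhr hlam _ S _ P _ X _ _ _
    have hset : {ω | |TSNE.discreteAttraction η σ h T (fun i => X i ω) -
              TSNE.continuumAttraction Ω ρ η σ 1 T| ≤
            1 * ((TSNE.lip T Ω : ℝ) ^ 2 + (TSNE.lip (fderiv ℝ T) Ω : ℝ) ^ 2) *
              (lam / Real.sqrt ((n : ℝ) * h ^ 0) +
                TSNE.tailMass 0 η (r / (h * σmax)) + r)} = Set.univ := by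
      refine Set.eq_univ_of_forall fun ω => ?_
      obtain ⟨h1, h2⟩ := TSNE.attraction_eq_zero_of_dim_zero Ω ρ η σ h T (fun i => X i ω)
      have h3 := TSNE.tailMass_nonneg hη (r / (h * σmax))
      have hr : 0 ≤ r := hh.le.trans hhr
      rw [Set.mem_ofPred_eq, h1, h2, sub_zero, abs_zero]
      positivity
    rw [hset, probReal_univ]
    linarith [show 0 ≤ 3 * (n : ℝ) * Real.exp (-lam ^ 2) by positivity]
  · have : NeZero d := ⟨hd⟩
    exact TSNE.exists_concentration_of_neZero d m Ω hΩ_open hΩ_bdd hΩ_lip ρ ρmin ρmax hρ η hη σ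
      σmin σmax hσ
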